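/- Let $\mu$ be a $\sigma$-finite measure on a measurable space $\mathcal X$, let $\{f_\theta:\theta\in\Theta\}$, $\Theta\subset\mathbb R^p$, be a family of probability densities with respect to $\mu$, and let $\beta\ge 0$. Write $u_\theta(x)=\partial_\theta\log f_\theta(x)$, $\xi_\beta(\theta)=\int u_\theta f_\theta^{1+\beta}\,d\mu$, $$J_\beta(\theta)=\int u_\theta u_\theta^T f_\theta^{1+\beta}\,d\mu,\qquad K_\beta(\theta)=\int u_\theta u_\theta^T f_\theta^{1+2\beta}\,d\mu-\xi_\beta(\theta)\xi_\beta(\theta)^T,\qquad \Sigma_\beta(\theta)=J_\beta^{-1}(\theta)K_\beta(\theta)J_\beta^{-1}(\theta),$$ and $V_\theta(x)=\int f_\theta^{1+\beta}d\mu-(1+\tfrac1\beta)f_\theta^\beta(x)$ if $\beta>0$, $V_\theta(x)=-\log f_\theta(x)$ if $\beta=0$. Fix $\theta_0\in\Theta$. Assume the standard regularity conditions (D1--D5 of Basu, Shioya and Park) when $f_{\theta_0}$ is the true density: (D1) all $f_\theta$, $\theta\in\Theta$, have the same support $\{f_\theta>0\}$; (D2) there is an open set $\omega\subset\Theta$ with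 $\theta_0\in\omega$ such that for almost every $x$ in the support $\theta\mapsto f_\theta(x)$ is three times continuously differentiable on $\omega$; (D3) $\int f_\theta^{1+\beta}d\mu$ and $\int f_\theta^{\beta}f_{\theta_0}d\mu$ are finite and can be differentiated three times with respect to $\theta\in\omega$ under the integral sign; (D4) $J_\beta(\theta_0)$ is positive definite; (D5) each third partial derivative of $V_\theta(x)$ with respect to $\theta$ is bounded in absolute value, uniformly in $\theta\in\omega$, by a function of $x$ that is integrable under $f_{\theta_0}$. Assume also that $\int \|u_\theta\|^2f_\theta^{1+2\beta}d\mu<\infty$ for $\theta\in\omega$, so that $K_\beta$ exists there, and that $K_\beta$ is continuous at $\theta_0$ with $K_\beta(\theta_0)$ invertible. Let $d\in\mathbb R^p$ be such that $\theta_n=\theta_0+n^{-1/2}d\in\Theta$ for all $n\ge1$, and suppose that the alternatives $H_{1,n}:\theta=\theta_n$ are contiguous to the null hypothesis $H_0:\theta=\theta_0$, i.e. the joint law of a random sample of size $n$ from $f_{\theta_n}$ is contiguous (in the sense of Le Cam) with respect to that of a random sample of size $n$ from $f_{\theta_0}$. A consistent sequence of minimum density power divergence estimators (MDPDE) is a sequence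 of measurable $\Theta$-valued functions $\widehat\theta_\beta=\widehat\theta_{\beta,n}(X_1,\dots,X_n)$ such that, when $f_{\theta_0}$ is the true density, $\widehat\theta_\beta\to\theta_0$ in probability and, with probability tending to one, $\widehat\theta_\beta$ is a root of the estimating equation $\frac1n\sum_{i=1}^n u_\theta(X_i)f_\theta^\beta(X_i)-\int u_\theta f_\theta^{1+\beta}d\mu=0$. Such a sequence exists, and for every such sequence, if for each $n$ the sample $X_1,\dots,X_n$ is drawn independently from $f_{\theta_n}$, the Wald-type statistic $$W_n=n\,(\widehat\theta_\beta-\theta_0)^T\,\Sigma_\beta(\theta_0)^{-1}\,(\widehat\theta_\beta-\theta_0)$$ converges in distribution to the noncentral chi-square distribution with $p$ degrees of freedom and noncentrality parameter $$\delta=d^T\,\Sigma_\beta(\theta_0)^{-1}\,d=d^T\left(J_\beta^{-1}(\theta_0)K_\beta(\theta_0)J_\beta^{-1}(\theta_0)\right)^{-1}d .$$ Here the noncentral chi-square distribution with parameter $\delta$ is the law of $Z_1^2+\dots+Z_p^2$ with independent $Z_i\sim N(m_i,1)$ and $\sum_i m_i^2=\delta$. -/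

import Mathlib

open MeasureTheory ProbabilityTheory Filter Topology
open scoped Matrix BoundedContinuousFunction

namespace DPD

noncomputable section

/-- A family of probability densities `f θ`, `θ ∈ Θ`, with respect to the dominating measure `μ`.
(Values of `f` at parameters outside `Θ` play no role.) -/
structure IsDensityFamily {𝓧 : Type*} [MeasurableSpace 𝓧] (μ : Measure 𝓧) {p : ℕ}
    (Θ : Set (EuclideanSpace ℝ (Fin p))) (f : EuclideanSpace ℝ (Fin p) → 𝓧 → ℝ) : Prop where
  measurable : ∀ θ ∈ Θ, Measurable (f θ)
  nonneg : ∀ θ ∈ Θ, ∀ x, 0 ≤ f θ x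
  integral_eq_one : ∀ θ ∈ Θ, ∫ x, f θ x ∂μ = 1

/-- The distribution with density `g` with respect to `μ`. -/
def law {𝓧 : Type*} [MeasurableSpace 𝓧] (μ : Measure 𝓧) (g : 𝓧 → ℝ) : Measure 𝓧 :=
  μ.withDensity fun x => ENNReal.ofReal (g x)

/-- The joint distribution of a random sample `X₁, …, Xₙ` from the density `g`. -/
def sampleLaw {𝓧 : Type*} [MeasurableSpace 𝓧] (μ : Measure 𝓧) (g : 𝓧 → ℝ) (n : ℕ) :
    Measure (Fin n → 𝓧) :=
  Measure.pi fun _ => law μ g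

section Model

variable {𝓧 : Type*} {p : ℕ}

/-- The score `u_θ(x) = ∂/∂θ log f_θ(x)`. -/
def score (f : EuclideanSpace ℝ (Fin p) → 𝓧 → ℝ) (θ : EuclideanSpace ℝ (Fin p)) (x : 𝓧) :
    EuclideanSpace ℝ (Fin p) :=
  gradient (fun η => Real.log (f η x)) θ

/-- `I_θ(x) = - ∂/∂θᵀ u_θ(x)`. -/
def infoMat (f : EuclideanSpace ℝ (Fin p) → 𝓧 → ℝ) (θ : EuclideanSpace ℝ (Fin p)) (x : 𝓧) :
    Matrix (Fin p) (Fin p) ℝ :=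
  Matrix.of fun i j =>
    -(fderiv ℝ (fun η => score f η x) θ (EuclideanSpace.single j (1 : ℝ))) i

variable [MeasurableSpace 𝓧]

/-- `V_θ(x) = ∫ f_θ^{1+β} dμ - (1 + 1/β) f_θ(x)^β` for `β > 0`, and `V_θ(x) = - log f_θ(x)` for
`β = 0`; the minimum density power divergence estimator minimizes `n⁻¹ ∑ V_θ(X_i)`. -/
def objective (μ : Measure 𝓧) (β : ℝ) (f : EuclideanSpace ℝ (Fin p) → 𝓧 → ℝ)
    (θ : EuclideanSpace ℝ (Fin p)) (x : 𝓧) : ℝ :=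
  if β = 0 then -Real.log (f θ x)
  else ∫ y, f θ y ^ (1 + β) ∂μ - (1 + 1 / β) * f θ x ^ β

/-- `J_β(θ) = ∫ u uᵀ f_θ^{1+β} + ∫ (I_θ - β u uᵀ) (g - f_θ) f_θ^β`, for the true density `g`. -/
def Jmat (μ : Measure 𝓧) (β : ℝ) (f : EuclideanSpace ℝ (Fin p) → 𝓧 → ℝ) (g : 𝓧 → ℝ)
    (θ : EuclideanSpace ℝ (Fin p)) : Matrix (Fin p) (Fin p) ℝ :=
  Matrix.of fun i j =>
    ∫ x, score f θ x i * score f θ x j * f θ x ^ (1 + β) ∂μ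
      + ∫ x, (infoMat f θ x i j - β * (score f θ x i * score f θ x j)) * (g x - f θ x)
          * f θ x ^ β ∂μ

/-- `ξ_β(θ) = ∫ u_θ f_θ^β g`, for the true density `g`. -/
def xiVec (μ : Measure 𝓧) (β : ℝ) (f : EuclideanSpace ℝ (Fin p) → 𝓧 → ℝ) (g : 𝓧 → ℝ)
    (θ : EuclideanSpace ℝ (Fin p)) : Fin p → ℝ :=
  fun i => ∫ x, score f θ x i * f θ x ^ β * g x ∂μ

/-- `K_β(θ) = ∫ u uᵀ f_θ^{2β} g - ξ_β(θ) ξ_β(θ)ᵀ`, for the true density `g`. -/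
def Kmat (μ : Measure 𝓧) (β : ℝ) (f : EuclideanSpace ℝ (Fin p) → 𝓧 → ℝ) (g : 𝓧 → ℝ)
    (θ : EuclideanSpace ℝ (Fin p)) : Matrix (Fin p) (Fin p) ℝ :=
  Matrix.of fun i j =>
    ∫ x, score f θ x i * score f θ x j * f θ x ^ (2 * β) * g x ∂μ
      - xiVec μ β f g θ i * xiVec μ β f g θ j

/-- The asymptotic covariance `J_β⁻¹(θ) K_β(θ) J_β⁻¹(θ)` at the model, i.e. when the true density
is `g = f_θ`. -/
def asympCov (μ : Measure 𝓧) (β : ℝ) (f : EuclideanSpace ℝ (Fin p) → 𝓧 → ℝ)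
    (θ : EuclideanSpace ℝ (Fin p)) : Matrix (Fin p) (Fin p) ℝ :=
  (Jmat μ β f (f θ) θ)⁻¹ * Kmat μ β f (f θ) θ * (Jmat μ β f (f θ) θ)⁻¹

/-- The integral `∫ h θ x dν(x)` is finite and can be differentiated three times with respect to
`θ ∈ ω`, the derivatives being taken under the integral sign. -/
structure DiffThriceUnderIntegral (ν : Measure 𝓧) (ω : Set (EuclideanSpace ℝ (Fin p)))
    (h : EuclideanSpace ℝ (Fin p) → 𝓧 → ℝ) : Prop where
  differentiable : ∀ k < 3,
    DifferentiableOn ℝ (iteratedFDeriv ℝ k fun η => ∫ x, h η x ∂ν) ω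
  integrable : ∀ k ≤ 3, ∀ θ ∈ ω, Integrable (fun x => iteratedFDeriv ℝ k (fun η => h η x) θ) ν
  deriv_eq : ∀ k ≤ 3, ∀ θ ∈ ω,
    iteratedFDeriv ℝ k (fun η => ∫ x, h η x ∂ν) θ
      = ∫ x, iteratedFDeriv ℝ k (fun η => h η x) θ ∂ν

/-- The regularity conditions D1–D5 of Basu, Shioya and Park for the minimum density power
divergence estimator, for the true density `g` with best fitting parameter `θg`; `ω` is the open
set of condition D2. -/
structure RegularityConditions (μ : Measure 𝓧) (β : ℝ) (Θ : Set (EuclideanSpace ℝ (Fin p)))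
    (f : EuclideanSpace ℝ (Fin p) → 𝓧 → ℝ) (g : 𝓧 → ℝ) (θg : EuclideanSpace ℝ (Fin p))
    (ω : Set (EuclideanSpace ℝ (Fin p))) : Prop where
  /-- D1: all model densities and `g` are positive on the same set. -/
  common_support : ∃ χ : Set 𝓧, (∀ θ ∈ Θ, ∀ x, 0 < f θ x ↔ x ∈ χ) ∧ ∀ x, 0 < g x ↔ x ∈ χ
  /-- D2: `ω` is an open subset of `Θ` containing the best fitting parameter, on which the
  densities are three times continuously differentiable, for almost all `x` in the support. -/
  isOpen : IsOpen ω
  subset : ω ⊆ Θ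
  mem : θg ∈ ω
  contDiffOn : ∀ᵐ x ∂μ, 0 < g x → ContDiffOn ℝ 3 (fun θ => f θ x) ω
  /-- D3: `∫ f_θ^{1+β}` and `∫ f_θ^β g` can be differentiated thrice under the integral sign. -/
  diff_model : DiffThriceUnderIntegral μ ω fun θ x => f θ x ^ (1 + β)
  diff_cross : DiffThriceUnderIntegral (law μ g) ω fun θ x => f θ x ^ β
  /-- D4: `J_β` is positive definite (at the best fitting parameter). -/
  posDef : (Jmat μ β f g θg).PosDef
  /-- D5: the third partial derivatives of `V_θ` are dominated on `ω` by functions with finite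
  expectation under `g`. -/
  dominated : ∃ M : Fin p → Fin p → Fin p → 𝓧 → ℝ,
    (∀ j k l, Integrable (M j k l) (law μ g)) ∧
    ∀ j k l, ∀ᵐ x ∂(law μ g), ∀ θ ∈ ω,
      |iteratedFDeriv ℝ 3 (fun η => objective μ β f η x) θ
        ![EuclideanSpace.single j 1, EuclideanSpace.single k 1, EuclideanSpace.single l 1]|
        ≤ M j k l x

/-- `θ` solves the estimating equation
`n⁻¹ ∑ u_θ(X_i) f_θ(X_i)^β - ∫ u_θ f_θ^{1+β} dμ = 0` for the sample `X`. -/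
def SolvesEstimatingEq (μ : Measure 𝓧) (β : ℝ) (f : EuclideanSpace ℝ (Fin p) → 𝓧 → ℝ) {n : ℕ}
    (X : Fin n → 𝓧) (θ : EuclideanSpace ℝ (Fin p)) : Prop :=
  (n : ℝ)⁻¹ • ∑ k, (f θ (X k) ^ β) • score f θ (X k)
    - ∫ x, (f θ x ^ (1 + β)) • score f θ x ∂μ = 0

/-- `T n` (`n = 1, 2, …`) is a sequence of minimum density power divergence estimators in the sense
in which their asymptotic theory is valid: under the model density `f_θ₀`, `T n` is a root of the
estimating equation with probability tending to one, and `T n → θ₀` in probability. -/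
structure IsConsistentMDPDE (μ : Measure 𝓧) (β : ℝ) (Θ : Set (EuclideanSpace ℝ (Fin p)))
    (f : EuclideanSpace ℝ (Fin p) → 𝓧 → ℝ) (θ₀ : EuclideanSpace ℝ (Fin p))
    (T : (n : ℕ) → (Fin n → 𝓧) → EuclideanSpace ℝ (Fin p)) : Prop where
  measurable : ∀ n, Measurable (T n)
  mem : ∀ n X, T n X ∈ Θ
  root : Tendsto (fun n => sampleLaw μ (f θ₀) n {X | ¬ SolvesEstimatingEq μ β f X (T n X)})
    atTop (𝓝 0)
  consistent : ∀ ε > 0,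
    Tendsto (fun n => sampleLaw μ (f θ₀) n {X | ε ≤ dist (T n X) θ₀}) atTop (𝓝 0)

/-- The Wald-type statistic
`W_n = n (θ̂ - θ₀)ᵀ (J_β⁻¹(θ₀) K_β(θ₀) J_β⁻¹(θ₀))⁻¹ (θ̂ - θ₀)`, where `θ̂ = T n X`. -/
def waldStat (μ : Measure 𝓧) (β : ℝ) (f : EuclideanSpace ℝ (Fin p) → 𝓧 → ℝ)
    (θ₀ : EuclideanSpace ℝ (Fin p)) (T : (n : ℕ) → (Fin n → 𝓧) → EuclideanSpace ℝ (Fin p))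
    (n : ℕ) (X : Fin n → 𝓧) : ℝ :=
  n * ((T n X - θ₀).ofLp ⬝ᵥ ((asympCov μ β f θ₀)⁻¹ *ᵥ (T n X - θ₀).ofLp))

end Model

/-- The local alternative `θ_n = θ₀ + n^{-1/2} d`. -/
def localAlt {p : ℕ} (θ₀ d : EuclideanSpace ℝ (Fin p)) (n : ℕ) : EuclideanSpace ℝ (Fin p) :=
  θ₀ + (Real.sqrt n)⁻¹ • d

/-- `Q` is contiguous with respect to `P` (Le Cam): `P n (A n) → 0` implies `Q n (A n) → 0`. -/
def IsContiguous {Ω : ℕ → Type*} [∀ n, MeasurableSpace (Ω n)] (Q P : (n : ℕ) → Measure (Ω n)) :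
    Prop :=
  ∀ A : (n : ℕ) → Set (Ω n), (∀ n, MeasurableSet (A n)) →
    Tendsto (fun n => P n (A n)) atTop (𝓝 0) → Tendsto (fun n => Q n (A n)) atTop (𝓝 0)

/-- The noncentral chi-square distribution with `p` degrees of freedom and noncentrality parameter
`δ ≥ 0`: the law of `Z₁² + ⋯ + Z_p²` for independent `Z_i ~ N(m_i, 1)` with `∑ m_i² = δ`. By
rotation invariance this does not depend on the choice of such `m_i`; here `m_i = √(δ/p)`. -/
def noncentralChiSq (p : ℕ) (δ : ℝ) : Measure ℝ :=
  (Measure.pi fun _ : Fin p => gaussianReal (Real.sqrt (δ / p)) 1).map fun z => ∑ i, z i ^ 2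

/-- Convergence in law of the random variables `W n`, defined on the probability spaces
`(Ω n, P n)`, to the distribution `ν`. -/
def ConvergesInLaw {Ω : ℕ → Type*} [∀ n, MeasurableSpace (Ω n)] (P : (n : ℕ) → Measure (Ω n))
    (W : (n : ℕ) → Ω n → ℝ) (ν : Measure ℝ) : Prop :=
  ∀ φ : ℝ →ᵇ ℝ, Tendsto (fun n => ∫ x, φ (W n x) ∂(P n)) atTop (𝓝 (∫ w, φ w ∂ν))

end

end DPD

set_option maxSynthPendingDepth 3

/-! The estimator is centred at the alternative $\theta_n$ instead of at $\theta_0$. The estimating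
function `dpdScore`, $\psi_\theta=f_\theta^\beta u_\theta-\int u_\theta f_\theta^{1+\beta}d\mu$, has
mean zero and covariance $K_\beta(\theta)$ under $f_\theta$ itself. So
$n^{-1/2}\sum_i\psi_{\theta_n}(X_i)$ is, under $f_{\theta_n}$, a normalized sum of a centred rowwise
i.i.d. array, and it tends to $N(0,K_\beta(\theta_0))$ by continuity of $K_\beta$. No expansion of
the likelihood ratio enters. In place of a Lindeberg condition, `tendsto_charFun_array` uses
pointwise convergence of densities and summands together with convergence of second moments; this is
enough for dominated convergence with varying dominating functions
(`tendsto_integral_norm_of_dominated`).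

To reach the estimator, note that $-(1+\beta)\psi_\theta$ is the gradient of $V_\theta$, whose
Hessian at $\theta_0$ has mean $(1+\beta)J_\beta(\theta_0)$. With the third derivative bound D5 and
the law of large numbers, the empirical mean satisfies $\bar\psi(a)-\bar\psi(b)=-J(a-b)$ up to
$\eta\|a-b\|$ on a whole ball around $\theta_0$, with probability tending to one under
$f_{\theta_0}$ (`exists_linearization`). Taking $a=\widehat\theta$ and $b=\theta_n$ gives $\sqrt
n(\widehat\theta-\theta_n)\approx J^{-1}\sqrt n\,\bar\psi(\theta_n)$, with an error that is small
relative to the left side, so no rate for $\widehat\theta$ is needed beforehand. Contiguity serves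
only to carry this event over to $f_{\theta_n}$; `tendsto_charFun_of_relative_error` is the matching
form of Slutsky's theorem. The same linearization makes $\theta\mapsto\theta+J^{-1}\bar\psi(\theta)$
a contraction, which yields the existence of a consistent root.

Finally choose $C$ with $C^TC=\Sigma_\beta^{-1}$ and $Cd=w$, the vector with all coordinates
$\sqrt{\delta/p}$. Then $W_n=\|C\sqrt n(\widehat\theta-\theta_n)+w\|^2$, and the continuous mapping
theorem gives the limit. -/

namespace DPD

/-! ### Law of large numbers for samples, and dominated convergence -/

/-- The projection of an i.i.d. sequence to its first `n` terms is an i.i.d. sample. -/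
theorem measurePreserving_infinitePi_fin {𝓧 : Type*} [MeasurableSpace 𝓧] (P : Measure 𝓧)
    [IsProbabilityMeasure P] (n : ℕ) :
    MeasurePreserving (fun (x : ℕ → 𝓧) (i : Fin n) => x i)
      (Measure.infinitePi fun _ => P) (Measure.pi fun _ => P) := by
  refine ⟨by fun_prop, ?_⟩
  rw [← Measure.infinitePi_eq_pi]
  exact Measure.map_infinitePi_infinitePi_of_inj (P := fun _ : ℕ => P) Fin.val_injective

theorem ae_pi_forall {𝓧 : Type*} [MeasurableSpace 𝓧] {P : Measure 𝓧} [IsProbabilityMeasure P]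
    {q : 𝓧 → Prop} (h : ∀ᵐ x ∂P, q x) (n : ℕ) :
    ∀ᵐ X ∂(Measure.pi fun _ : Fin n => P), ∀ i, q (X i) :=
  ae_all_iff.2 fun i =>
    (measurePreserving_eval (fun _ : Fin n => P) i).quasiMeasurePreserving.ae h

/-- The weak law of large numbers for random samples. -/
theorem weak_law {𝓧 : Type*} [MeasurableSpace 𝓧] (P : Measure 𝓧) [IsProbabilityMeasure P]
    {F : Type*} [NormedAddCommGroup F] [NormedSpace ℝ F] [CompleteSpace F]
    {h : 𝓧 → F} (hi : Integrable h P) {ε : ℝ} (hε : 0 < ε) :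
    Tendsto (fun n : ℕ => (Measure.pi fun _ : Fin n => P)
      {X | ε ≤ ‖(n : ℝ)⁻¹ • ∑ i, h (X i) - ∫ x, h x ∂P‖}) atTop (𝓝 0) := by
  borelize F
  -- `h` is only a.e. strongly measurable; a strongly measurable version makes the events
  -- measurable, so that they can be pulled back to the infinite product.
  set g := hi.1.mk h with hg
  have hgm : StronglyMeasurable g := hi.1.stronglyMeasurable_mk
  have hgh : h =ᵐ[P] g := hi.1.ae_eq_mk
  have hgi : Integrable g P := hi.congr hgh
  set Q := Measure.infinitePi fun _ : ℕ => P with hQ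
  have hmp : ∀ i : ℕ, MeasurePreserving (fun x : ℕ → 𝓧 => x i) Q P := fun i =>
    measurePreserving_eval_infinitePi (fun _ : ℕ => P) i
  have hind : ∀ i : ℕ, IdentDistrib (fun x : ℕ → 𝓧 => g (x i)) (fun x : ℕ → 𝓧 => g (x 0)) Q Q := by
    intro i
    refine ⟨(hgm.measurable.comp (measurable_pi_apply i)).aemeasurable,
      (hgm.measurable.comp (measurable_pi_apply 0)).aemeasurable, ?_⟩
    have : ∀ j : ℕ, Measure.map (fun x : ℕ → 𝓧 => g (x j)) Q = Measure.map g P := by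
      intro j
      rw [← (hmp j).map_eq, Measure.map_map hgm.measurable (hmp j).measurable]
      rfl
    rw [this, this]
  have hsl := strong_law_ae (μ := Q) (fun i (x : ℕ → 𝓧) => g (x i))
    ((hmp 0).integrable_comp_of_integrable hgi)
    (fun i j hij => (iIndepFun_infinitePi (P := fun _ : ℕ => P) (X := fun _ => g)
      (fun _ => hgm.measurable)).indepFun hij) hind
  have hmean : ∫ x, g (x 0) ∂Q = ∫ x, h x ∂P := by
    rw [integral_congr_ae hgh, ← (hmp 0).map_eq,
      integral_map (hmp 0).measurable.aemeasurable hgm.aestronglyMeasurable]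
  rw [hmean] at hsl
  have hmeas : ∀ n : ℕ, StronglyMeasurable
      (fun X : Fin n → 𝓧 => (n : ℝ)⁻¹ • ∑ i, g (X i)) := fun n =>
    (Finset.stronglyMeasurable_fun_sum _ fun i _ =>
      hgm.comp_measurable (measurable_pi_apply i)).const_smul _
  have hcomp : ∀ (n : ℕ) (x : ℕ → 𝓧), (n : ℝ)⁻¹ • ∑ i ∈ Finset.range n, g (x i)
      = (n : ℝ)⁻¹ • ∑ i : Fin n, g (x i) := fun n x => by
    rw [Finset.sum_range (fun i => g (x i))]
  simp_rw [hcomp] at hsl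
  have htm := tendstoInMeasure_of_tendsto_ae (fun n => ((hmeas n).comp_measurable
    (measurePreserving_infinitePi_fin P n).measurable).aestronglyMeasurable) hsl
  rw [tendstoInMeasure_iff_norm] at htm
  refine (htm ε hε).congr fun n => ?_
  have hset : MeasurableSet {X : Fin n → 𝓧 | ε ≤ ‖(n : ℝ)⁻¹ • ∑ i, g (X i) - ∫ x, h x ∂P‖} :=
    measurableSet_le measurable_const (((hmeas n).sub stronglyMeasurable_const).norm.measurable)
  have h1 := (measurePreserving_infinitePi_fin P n).measure_preimage hset.nullMeasurableSet
  have h2 : (Measure.pi fun _ : Fin n => P)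
      {X | ε ≤ ‖(n : ℝ)⁻¹ • ∑ i, g (X i) - ∫ x, h x ∂P‖}
      = (Measure.pi fun _ : Fin n => P)
      {X | ε ≤ ‖(n : ℝ)⁻¹ • ∑ i, h (X i) - ∫ x, h x ∂P‖} := by
    refine measure_congr ?_
    filter_upwards [ae_pi_forall hgh n] with X hX
    change (ε ≤ _) = (ε ≤ _)
    simp [hX]
  rw [← h2, ← h1]
  rfl

/-- Dominated convergence with dominating functions whose integrals converge. -/
theorem tendsto_integral_norm_of_dominated {𝓧 : Type*} [MeasurableSpace 𝓧] {μ : Measure 𝓧}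
    {F : Type*} [NormedAddCommGroup F] {h : ℕ → 𝓧 → F} {g : ℕ → 𝓧 → ℝ} {g₀ : 𝓧 → ℝ}
    (hm : ∀ᶠ n in atTop, AEStronglyMeasurable (h n) μ)
    (hg : ∀ᶠ n in atTop, Integrable (g n) μ) (hg₀ : Integrable g₀ μ)
    (hbound : ∀ᶠ n in atTop, ∀ᵐ x ∂μ, ‖h n x‖ ≤ g n x)
    (hpos : ∀ᵐ x ∂μ, 0 ≤ g₀ x)
    (hlim : ∀ᵐ x ∂μ, Tendsto (fun n => g n x) atTop (𝓝 (g₀ x)))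
    (hint : Tendsto (fun n => ∫ x, g n x ∂μ) atTop (𝓝 (∫ x, g₀ x ∂μ)))
    (hzero : ∀ᵐ x ∂μ, Tendsto (fun n => h n x) atTop (𝓝 0)) :
    Tendsto (fun n => ∫ x, ‖h n x‖ ∂μ) atTop (𝓝 0) := by
  -- The bound is $\|h_n\|\le\min(\|h_n\|,g_0)+(g_n-g_0)^+$ with
  -- $(g_n-g_0)^+=(g_n-g_0)+(g_0-g_n)^+$. Both the minimum and $(g_0-g_n)^+$ are dominated by the
  -- fixed function $g_0$.
  have h1 : Tendsto (fun n => ∫ x, min ‖h n x‖ (g₀ x) ∂μ) atTop (𝓝 (∫ _, (0 : ℝ) ∂μ)) := by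
    refine tendsto_integral_filter_of_dominated_convergence g₀ ?_ ?_ hg₀ ?_
    · filter_upwards [hm] with n hn
      exact hn.norm.inf hg₀.1
    · refine Eventually.of_forall fun n => ?_
      filter_upwards [hpos] with x hx
      rw [Real.norm_of_nonneg (le_min (norm_nonneg _) hx)]
      exact min_le_right _ _
    · filter_upwards [hzero, hpos] with x hx hp
      have := (tendsto_norm_zero.comp hx).min (tendsto_const_nhds (x := g₀ x))
      simpa [min_eq_left hp] using this
  have h2 : Tendsto (fun n => ∫ x, max (g₀ x - g n x) 0 ∂μ) atTop (𝓝 (∫ _, (0 : ℝ) ∂μ)) := by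
    refine tendsto_integral_filter_of_dominated_convergence g₀ ?_ ?_ hg₀ ?_
    · filter_upwards [hg] with n hn
      exact (hg₀.1.sub hn.1).sup aestronglyMeasurable_const
    · filter_upwards [hbound] with n hn
      filter_upwards [hn, hpos] with x hx hp
      rw [Real.norm_of_nonneg (le_max_right _ _)]
      exact max_le (by linarith [norm_nonneg (h n x)]) hp
    · filter_upwards [hlim] with x hx
      have := ((tendsto_const_nhds (x := g₀ x)).sub hx).max (tendsto_const_nhds (x := (0 : ℝ)))
      simpa using this
  have h3 : Tendsto (fun n => ∫ x, min ‖h n x‖ (g₀ x) ∂μ + ((∫ x, g n x ∂μ - ∫ x, g₀ x ∂μ)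
      + ∫ x, max (g₀ x - g n x) 0 ∂μ)) atTop (𝓝 0) := by
    simpa using h1.add ((hint.sub_const (∫ x, g₀ x ∂μ)).add h2)
  refine squeeze_zero' (Eventually.of_forall fun n => integral_nonneg fun x => norm_nonneg _) ?_ h3
  filter_upwards [hm, hg, hbound] with n hmn hgn hbn
  have i1 : Integrable (fun x => min ‖h n x‖ (g₀ x)) μ := by
    refine hg₀.mono (hmn.norm.inf hg₀.1) ?_
    filter_upwards [hpos] with x hx
    rw [Real.norm_of_nonneg (le_min (norm_nonneg _) hx), Real.norm_of_nonneg hx]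
    exact min_le_right _ _
  have i2 : Integrable (fun x => max (g₀ x - g n x) 0) μ := (hg₀.sub hgn).pos_part
  have i3 : Integrable (fun x => g n x - g₀ x) μ := hgn.sub hg₀
  have i4 : Integrable (fun x => g n x - g₀ x + max (g₀ x - g n x) 0) μ := i3.add i2
  rw [← integral_sub hgn hg₀, ← integral_add i3 i2, ← integral_add i1 i4]
  refine integral_mono_ae (hgn.mono' hmn hbn).norm (i1.add i4) ?_
  filter_upwards [hbn] with x hx
  rcases le_total ‖h n x‖ (g₀ x) with hc | hc
  · rw [min_eq_left hc]
    linarith [le_max_left (g₀ x - g n x) 0]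
  · rw [min_eq_right hc]
    linarith [le_max_left (g₀ x - g n x) 0, le_max_right (g₀ x - g n x) 0]

/-! ### Second order expansion of the characteristic function -/

/-- The remainder of the second order expansion of the characteristic function integrand. -/
noncomputable def expRem (u : ℝ) : ℂ :=
  Complex.exp (u * Complex.I) - 1 - u * Complex.I + (u : ℂ) ^ 2 / 2

theorem norm_expRem_le_cube {u : ℝ} (hu : |u| ≤ 1) : ‖expRem u‖ ≤ |u| ^ 3 := by
  have h := Complex.exp_bound (x := u * Complex.I) (by simpa using hu) (n := 3) (by norm_num)
  have h1 : expRem u = Complex.exp (u * Complex.I)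
      - ∑ m ∈ Finset.range 3, (u * Complex.I) ^ m / (m.factorial : ℂ) := by
    simp [Finset.sum_range_succ, expRem, mul_pow, Nat.factorial]
    ring
  rw [h1]
  refine h.trans ?_
  simp [Nat.factorial]
  nlinarith [pow_nonneg (abs_nonneg u) 3]

/-- The cubic bound gives smallness near zero; this global quadratic bound supplies a dominating
function when only second moments exist. For $|u|\ge1$ the four terms add up to at most
$2+|u|+u^2/2\le4u^2$. -/
theorem norm_expRem_le_sq (u : ℝ) : ‖expRem u‖ ≤ 4 * u ^ 2 := by
  rcases le_total |u| 1 with hu | hu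
  · refine (norm_expRem_le_cube hu).trans ?_
    rw [← sq_abs u]
    nlinarith [sq_nonneg |u|, abs_nonneg u]
  · have h1 : ‖Complex.exp (u * Complex.I)‖ = 1 := Complex.norm_exp_ofReal_mul_I u
    have h2 : ‖expRem u‖ ≤ ‖Complex.exp (u * Complex.I)‖ + ‖(1 : ℂ)‖ + ‖(u : ℂ) * Complex.I‖
        + ‖(u : ℂ) ^ 2 / 2‖ := by
      unfold expRem
      refine (norm_add_le _ _).trans (add_le_add ((norm_sub_le _ _).trans
        (add_le_add ((norm_sub_le _ _)) le_rfl)) le_rfl)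
    rw [h1] at h2
    simp at h2
    rw [← sq_abs u]
    rw [← sq_abs u] at h2
    nlinarith

theorem continuous_expRem : Continuous expRem := by
  unfold expRem; fun_prop

/-- By the cubic bound the norm is at most $n(|y_n|/\sqrt n)^3=|y_n|^3/\sqrt n$ once the argument is
at most one. -/
theorem tendsto_mul_expRem {y : ℕ → ℝ} {y₀ : ℝ} (hy : Tendsto y atTop (𝓝 y₀)) :
    Tendsto (fun n : ℕ => (n : ℂ) * expRem ((Real.sqrt n)⁻¹ * y n)) atTop (𝓝 0) := by
  have hs : Tendsto (fun n : ℕ => (Real.sqrt n)⁻¹) atTop (𝓝 0) :=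
    tendsto_inv_atTop_zero.comp (Real.tendsto_sqrt_atTop.comp tendsto_natCast_atTop_atTop)
  have h0 : Tendsto (fun n : ℕ => |(Real.sqrt n)⁻¹ * y n|) atTop (𝓝 0) := by
    simpa using (hs.mul hy).abs
  have hb : Tendsto (fun n : ℕ => |y n| ^ 3 * (Real.sqrt n)⁻¹) atTop (𝓝 0) := by
    simpa using (hy.abs.pow 3).mul hs
  refine squeeze_zero_norm' ?_ hb
  filter_upwards [h0.eventually (ge_mem_nhds zero_lt_one), eventually_ge_atTop 1] with n hn h1
  rw [norm_mul, Complex.norm_natCast]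
  refine (mul_le_mul_of_nonneg_left (norm_expRem_le_cube hn) (Nat.cast_nonneg n)).trans ?_
  have hn0 : (0 : ℝ) < n := by exact_mod_cast h1
  have hsq : Real.sqrt n ^ 2 = n := Real.sq_sqrt hn0.le
  have hs0 : 0 < Real.sqrt n := Real.sqrt_pos.2 hn0
  rw [abs_mul, abs_of_pos (inv_pos.2 hs0)]
  apply le_of_eq
  have : (n : ℝ) * ((Real.sqrt n)⁻¹ * |y n|) ^ 3
      = Real.sqrt n ^ 2 * ((Real.sqrt n)⁻¹ * |y n|) ^ 3 := by rw [hsq]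
  rw [this]
  field_simp

/-! ### Integration against a law with a density -/

section Law

variable {𝓧 : Type*} [MeasurableSpace 𝓧] {μ : Measure 𝓧} {g : 𝓧 → ℝ}

theorem integral_law {F : Type*} [NormedAddCommGroup F] [NormedSpace ℝ F]
    (hm : Measurable g) (h0 : ∀ x, 0 ≤ g x) (h : 𝓧 → F) :
    ∫ x, h x ∂(law μ g) = ∫ x, g x • h x ∂μ := by
  rw [law, integral_withDensity_eq_integral_toReal_smul hm.ennreal_ofReal (by simp)]
  simp [h0]

theorem integrable_law {F : Type*} [NormedAddCommGroup F] [NormedSpace ℝ F]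
    (hm : Measurable g) (h0 : ∀ x, 0 ≤ g x) {h : 𝓧 → F} :
    Integrable h (law μ g) ↔ Integrable (fun x => g x • h x) μ := by
  rw [law, integrable_withDensity_iff_integrable_smul' hm.ennreal_ofReal (by simp)]
  simp [h0]

theorem ae_law (hm : Measurable g) {q : 𝓧 → Prop} :
    (∀ᵐ x ∂(law μ g), q x) ↔ ∀ᵐ x ∂μ, 0 < g x → q x := by
  rw [law, ae_withDensity_iff hm.ennreal_ofReal]
  simp

theorem isProbabilityMeasure_law (h0 : ∀ x, 0 ≤ g x) (h1 : ∫ x, g x ∂μ = 1) :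
    IsProbabilityMeasure (law μ g) := by
  have hi : Integrable g μ := by
    by_contra h
    rw [integral_undef h] at h1
    exact zero_ne_one h1
  refine ⟨?_⟩
  rw [law, withDensity_apply _ MeasurableSet.univ, Measure.restrict_univ,
    ← ofReal_integral_eq_lintegral_ofReal hi (Eventually.of_forall h0), h1, ENNReal.ofReal_one]

end Law

/-! ### Central limit theorem for rowwise i.i.d. arrays -/

/-- Characteristic functions of normalized sums of rowwise i.i.d. centred real variables, whose
second moments converge to the second moment of the pointwise limit. -/
theorem tendsto_charFun_array {𝓧 : Type*} [MeasurableSpace 𝓧] {μ : Measure 𝓧}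
    {f : ℕ → 𝓧 → ℝ} {f₀ : 𝓧 → ℝ} {y : ℕ → 𝓧 → ℝ} {y₀ : 𝓧 → ℝ}
    (hfm : ∀ n, Measurable (f n)) (hf0 : ∀ n x, 0 ≤ f n x)
    (hP : ∀ n, IsProbabilityMeasure (law μ (f n)))
    (hf₀ : ∀ x, 0 ≤ f₀ x)
    (hy : ∀ᶠ n in atTop, MemLp (y n) 2 (law μ (f n)))
    (hmean : ∀ᶠ n in atTop, ∫ x, y n x ∂(law μ (f n)) = 0)
    (hvar : Tendsto (fun n => ∫ x, y n x ^ 2 ∂(law μ (f n))) atTop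
      (𝓝 (∫ x, f₀ x * y₀ x ^ 2 ∂μ)))
    (hint : Integrable (fun x => f₀ x * y₀ x ^ 2) μ)
    (hlim : ∀ᵐ x ∂μ, ((∀ᶠ n in atTop, f n x = 0) ∧ f₀ x = 0) ∨
      (Tendsto (fun n => y n x) atTop (𝓝 (y₀ x)) ∧ Tendsto (fun n => f n x) atTop (𝓝 (f₀ x)))) :
    Tendsto (fun n : ℕ => ∫ X, Complex.exp (((Real.sqrt n)⁻¹ * ∑ k, y n (X k) : ℝ) * Complex.I)
      ∂(Measure.pi fun _ : Fin n => law μ (f n))) atTop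
      (𝓝 (Complex.exp (-(∫ x, f₀ x * y₀ x ^ 2 ∂μ : ℝ) / 2))) := by
  set σ : ℝ := ∫ x, f₀ x * y₀ x ^ 2 ∂μ with hσ
  set φ : ℕ → ℂ := fun n => ∫ x, Complex.exp (((Real.sqrt n)⁻¹ * y n x : ℝ) * Complex.I)
    ∂(law μ (f n)) with hφ
  -- By independence the characteristic function is $(1+(\varphi_n-1))^n$, so it suffices that
  -- $n(\varphi_n-1)\to-\sigma/2$.
  have hprod : ∀ n : ℕ, ∫ X, Complex.exp (((Real.sqrt n)⁻¹ * ∑ k, y n (X k) : ℝ) * Complex.I)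
      ∂(Measure.pi fun _ : Fin n => law μ (f n)) = (1 + (φ n - 1)) ^ n := by
    intro n
    have hn := hP n
    have := integral_fintype_prod_eq_pow (ι := Fin n) (μ := law μ (f n))
      (fun x => Complex.exp (((Real.sqrt n)⁻¹ * y n x : ℝ) * Complex.I))
    rw [Fintype.card_fin] at this
    rw [add_sub_cancel, hφ, ← this]
    refine integral_congr_ae (Eventually.of_forall fun X => ?_)
    simp only
    rw [← Complex.exp_sum]
    push_cast
    rw [← Finset.sum_mul, ← Finset.mul_sum]
  simp_rw [hprod]
  refine Complex.tendsto_one_add_pow_exp_of_tendsto ?_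
  set r : ℕ → 𝓧 → ℂ := fun n x => (n : ℂ) * expRem ((Real.sqrt n)⁻¹ * y n x) with hr
  have hrb : ∀ n : ℕ, 1 ≤ n → ∀ x, ‖r n x‖ ≤ 4 * y n x ^ 2 := by
    intro n hn x
    have hn0 : (0 : ℝ) < n := by exact_mod_cast hn
    simp only [hr, norm_mul, Complex.norm_natCast]
    refine (mul_le_mul_of_nonneg_left (norm_expRem_le_sq _) hn0.le).trans (le_of_eq ?_)
    rw [mul_pow, inv_pow, Real.sq_sqrt hn0.le]
    field_simp
  have hri : ∀ᶠ n in atTop, Integrable (r n) (law μ (f n)) := by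
    filter_upwards [hy, eventually_ge_atTop 1] with n hn h1
    refine (hn.integrable_sq.const_mul 4).mono' ?_ (Eventually.of_forall (hrb n h1))
    exact (continuous_expRem.comp_aestronglyMeasurable (hn.1.const_mul _)).const_mul _
  have hr0 : Tendsto (fun n => ∫ x, r n x ∂(law μ (f n))) atTop (𝓝 0) := by
    -- The laws vary with $n$, so densities are moved into the integrands. The dominating functions
    -- $4f_ny_n^2$ also vary, and `hvar` is the convergence of their integrals.
    have key := tendsto_integral_norm_of_dominated (μ := μ)
      (h := fun n x => f n x • r n x) (g := fun n x => f n x • (4 * y n x ^ 2))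
      (g₀ := fun x => 4 * (f₀ x * y₀ x ^ 2)) ?_ ?_ (hint.const_mul 4) ?_ ?_ ?_ ?_ ?_
    · refine squeeze_zero_norm (fun n => ?_) key
      rw [integral_law (hfm n) (hf0 n)]
      exact norm_integral_le_integral_norm _
    · filter_upwards [hri] with n hn
      exact ((integrable_law (hfm n) (hf0 n)).1 hn).1
    · filter_upwards [hy] with n hn
      exact (integrable_law (hfm n) (hf0 n)).1 (hn.integrable_sq.const_mul 4)
    · filter_upwards [eventually_ge_atTop 1] with n h1
      refine Eventually.of_forall fun x => ?_
      rw [norm_smul, Real.norm_of_nonneg (hf0 n x), smul_eq_mul]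
      exact mul_le_mul_of_nonneg_left (hrb n h1 x) (hf0 n x)
    · exact Eventually.of_forall fun x => by have := hf₀ x; positivity
    · filter_upwards [hlim] with x hx
      rcases hx with ⟨h1, h2⟩ | ⟨h1, h2⟩
      · refine tendsto_const_nhds.congr' ?_
        filter_upwards [h1] with n hn
        simp [hn, h2]
      · rw [show 4 * (f₀ x * y₀ x ^ 2) = f₀ x * (4 * y₀ x ^ 2) by ring]
        exact h2.mul ((h1.pow 2).const_mul 4)
    · have h4 := hvar.const_mul 4
      rw [integral_const_mul]
      refine h4.congr fun n => ?_
      rw [← integral_law (hfm n) (hf0 n), integral_const_mul]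
    · filter_upwards [hlim] with x hx
      rcases hx with ⟨h1, h2⟩ | ⟨h1, h2⟩
      · refine tendsto_const_nhds.congr' ?_
        filter_upwards [h1] with n hn
        simp [hn]
      · simpa using h2.smul (tendsto_mul_expRem h1)
  have hlast : Tendsto (fun n => (-((∫ x, y n x ^ 2 ∂(law μ (f n)) : ℝ) : ℂ) / 2)
      + ∫ x, r n x ∂(law μ (f n))) atTop (𝓝 (-(σ : ℂ) / 2)) := by
    have h1 : Tendsto (fun n => ((∫ x, y n x ^ 2 ∂(law μ (f n)) : ℝ) : ℂ)) atTop (𝓝 (σ : ℂ)) :=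
      (Complex.continuous_ofReal.tendsto σ).comp hvar
    simpa using ((h1.neg).div_const 2).add hr0
  refine hlast.congr' ?_
  filter_upwards [hy, hmean, hri, eventually_ge_atTop 1] with n hn hm hin h1
  have hPn := hP n
  have hn0 : (n : ℂ) ≠ 0 := by exact_mod_cast (by omega : n ≠ 0)
  have hnr : (0 : ℝ) ≤ n := Nat.cast_nonneg n
  have hsq : ((Real.sqrt n : ℝ) : ℂ) ^ 2 = n := by
    rw [← Complex.ofReal_pow, Real.sq_sqrt hnr]; simp
  have hyi : Integrable (y n) (law μ (f n)) := hn.integrable (by norm_num)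
  -- The linear term integrates to zero by centring, the quadratic one gives minus half the
  -- variance, and `r n` is negligible.
  have hdec : ∀ x, (n : ℂ) * (Complex.exp (((Real.sqrt n)⁻¹ * y n x : ℝ) * Complex.I) - 1)
      = ((n : ℂ) * ((Real.sqrt n : ℝ) : ℂ)⁻¹ * Complex.I) * ((y n x : ℝ) : ℂ)
        + (-1 / 2) * ((y n x ^ 2 : ℝ) : ℂ) + r n x := by
    intro x
    have h3 : (n : ℂ) * ((((Real.sqrt n)⁻¹ * y n x : ℝ)) : ℂ) ^ 2 = ((y n x ^ 2 : ℝ) : ℂ) := by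
      push_cast
      rw [mul_pow, inv_pow, hsq]
      field_simp
    rw [← h3]
    simp only [hr, expRem]
    push_cast
    ring
  have hc : (n : ℂ) * (φ n - 1) = ∫ x, (n : ℂ) *
      (Complex.exp (((Real.sqrt n)⁻¹ * y n x : ℝ) * Complex.I) - 1) ∂(law μ (f n)) := by
    rw [integral_const_mul, integral_sub _ (integrable_const _)]
    · simp [hφ]
    · refine (integrable_const (1 : ℝ)).mono' ?_ (Eventually.of_forall fun x => by
        rw [Complex.norm_exp_ofReal_mul_I])
      exact (by fun_prop : Continuous fun u : ℝ => Complex.exp (u * Complex.I)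
        ).comp_aestronglyMeasurable (hn.1.const_mul _)
  rw [hc]
  simp_rw [hdec]
  have i1 : Integrable (fun x => ((n : ℂ) * ((Real.sqrt n : ℝ) : ℂ)⁻¹ * Complex.I)
      * ((y n x : ℝ) : ℂ)) (law μ (f n)) := hyi.ofReal.const_mul _
  have i2 : Integrable (fun x => (-1 / 2 : ℂ) * ((y n x ^ 2 : ℝ) : ℂ)) (law μ (f n)) :=
    hn.integrable_sq.ofReal.const_mul _
  have i12 : Integrable (fun x => ((n : ℂ) * ((Real.sqrt n : ℝ) : ℂ)⁻¹ * Complex.I)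
      * ((y n x : ℝ) : ℂ) + (-1 / 2 : ℂ) * ((y n x ^ 2 : ℝ) : ℂ)) (law μ (f n)) := i1.add i2
  have e1 : ∫ x, ((n : ℂ) * ((Real.sqrt n : ℝ) : ℂ)⁻¹ * Complex.I) * ((y n x : ℝ) : ℂ)
      ∂(law μ (f n)) = 0 := by
    rw [integral_const_mul, integral_complex_ofReal, hm]
    simp
  have e2 : ∫ x, (-1 / 2 : ℂ) * ((y n x ^ 2 : ℝ) : ℂ) ∂(law μ (f n))
      = -((∫ x, y n x ^ 2 ∂(law μ (f n)) : ℝ) : ℂ) / 2 := by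
    rw [integral_const_mul, integral_complex_ofReal]
    ring
  rw [integral_add i12 hin, integral_add i1 i2, e1, e2, zero_add]

/-! ### Lévy continuity and a relative-error Slutsky theorem -/

/-- Lévy's continuity theorem for random vectors on varying probability spaces. -/
theorem tendsto_integral_of_tendsto_charFun {E : Type*} [NormedAddCommGroup E]
    [InnerProductSpace ℝ E] [FiniteDimensional ℝ E] [MeasurableSpace E] [BorelSpace E]
    {Ω : ℕ → Type*} [∀ n, MeasurableSpace (Ω n)] (P : (n : ℕ) → Measure (Ω n))
    [∀ n, IsProbabilityMeasure (P n)] {V : (n : ℕ) → Ω n → E} (hV : ∀ n, AEMeasurable (V n) (P n))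
    (N : Measure E) [IsProbabilityMeasure N]
    (h : ∀ t : E, Tendsto (fun n => ∫ x, Complex.exp (inner ℝ (V n x) t * Complex.I) ∂(P n)) atTop
      (𝓝 (charFun N t))) (φ : E →ᵇ ℝ) :
    Tendsto (fun n => ∫ x, φ (V n x) ∂(P n)) atTop (𝓝 (∫ z, φ z ∂N)) := by
  let ρ : ℕ → ProbabilityMeasure E := fun n => ⟨(P n).map (V n), Measure.isProbabilityMeasure_map (hV n)⟩
  let ν : ProbabilityMeasure E := ⟨N, inferInstance⟩
  have h1 : Tendsto ρ atTop (𝓝 ν) := by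
    rw [ProbabilityMeasure.tendsto_iff_tendsto_charFun]
    intro t
    refine (h t).congr fun n => ?_
    change _ = charFun ((P n).map (V n)) t
    rw [charFun_apply, integral_map (hV n) (by fun_prop)]
  rw [ProbabilityMeasure.tendsto_iff_forall_integral_tendsto] at h1
  refine (h1 φ).congr fun n => ?_
  change ∫ z, φ z ∂((P n).map (V n)) = _
  rw [integral_map (hV n) φ.continuous.aestronglyMeasurable]

theorem norm_exp_inner_sub_le {E : Type*} [NormedAddCommGroup E]
    [InnerProductSpace ℝ E] (v s t : E) :
    ‖Complex.exp (inner ℝ v t * Complex.I) - Complex.exp (inner ℝ s t * Complex.I)‖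
      ≤ min 2 (‖v - s‖ * ‖t‖) := by
  refine le_min ?_ ?_
  · refine (norm_sub_le _ _).trans ?_
    rw [Complex.norm_exp_ofReal_mul_I, Complex.norm_exp_ofReal_mul_I]
    norm_num
  · have h1 : Complex.exp (inner ℝ v t * Complex.I) - Complex.exp (inner ℝ s t * Complex.I)
        = Complex.exp (inner ℝ s t * Complex.I)
          * (Complex.exp (Complex.I * (inner ℝ (v - s) t : ℝ)) - 1) := by
      rw [mul_sub, ← Complex.exp_add, inner_sub_left]
      push_cast
      ring_nf
    rw [h1, norm_mul, Complex.norm_exp_ofReal_mul_I, one_mul]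
    exact Real.norm_exp_I_mul_ofReal_sub_one_le.trans (norm_inner_le_norm _ _)

section Slutsky

variable {E : Type*} [NormedAddCommGroup E] [InnerProductSpace ℝ E] [FiniteDimensional ℝ E]
  [MeasurableSpace E] [BorelSpace E]

/-- If `S n` converges in law and `V n - S n` is negligible relative to `V n`, then the
characteristic functions of `V n` have the same limit. -/
theorem tendsto_charFun_of_relative_error {Ω : ℕ → Type*} [∀ n, MeasurableSpace (Ω n)]
    (P : (n : ℕ) → Measure (Ω n)) [∀ n, IsProbabilityMeasure (P n)]
    {V S : (n : ℕ) → Ω n → E} (hV : ∀ n, AEMeasurable (V n) (P n))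
    (hS : ∀ n, AEMeasurable (S n) (P n)) (N : Measure E) [IsProbabilityMeasure N]
    (h : ∀ t : E, Tendsto (fun n => ∫ x, Complex.exp (inner ℝ (S n x) t * Complex.I) ∂(P n)) atTop
      (𝓝 (charFun N t)))
    (herr : ∀ η > 0, Tendsto (fun n => P n {x | ¬ ‖V n x - S n x‖ ≤ η * ‖V n x‖}) atTop (𝓝 0))
    (t : E) :
    Tendsto (fun n => ∫ x, Complex.exp (inner ℝ (V n x) t * Complex.I) ∂(P n)) atTop
      (𝓝 (charFun N t)) := by
  have hexp : ∀ {U : (n : ℕ) → Ω n → E}, (∀ n, AEMeasurable (U n) (P n)) → ∀ n,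
      Integrable (fun x => Complex.exp (inner ℝ (U n x) t * Complex.I)) (P n) := by
    intro U hU n
    refine (integrable_const (1 : ℝ)).mono' ?_ (Eventually.of_forall fun x => by
      rw [Complex.norm_exp_ofReal_mul_I])
    exact (by fun_prop : Continuous fun u : E => Complex.exp (inner ℝ u t * Complex.I)
      ).comp_aestronglyMeasurable (hU n).aestronglyMeasurable
  have hcont : ∀ η : ℝ, Continuous fun s : E => min 2 (2 * |η| * ‖s‖ * ‖t‖) := fun η => by fun_prop
  have hbd : ∀ (η : ℝ) (s : E), ‖min 2 (2 * |η| * ‖s‖ * ‖t‖)‖ ≤ 2 := fun η s => by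
    rw [Real.norm_of_nonneg (by positivity)]
    exact min_le_left _ _
  -- Bounded continuous test functions majorizing the error in terms of `S n` alone; the absolute
  -- value keeps them nonnegative for every real `η`.
  let φ : ℝ → E →ᵇ ℝ := fun η => BoundedContinuousFunction.ofNormedAddCommGroup
    (fun s => min 2 (2 * |η| * ‖s‖ * ‖t‖)) (hcont η) 2 (hbd η)
  have hφ0 : Tendsto (fun η : ℝ => ∫ s, φ η s ∂N) (𝓝[>] 0) (𝓝 0) := by
    have : Tendsto (fun η : ℝ => ∫ s, φ η s ∂N) (𝓝[>] 0) (𝓝 (∫ _, (0 : ℝ) ∂N)) := by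
      refine tendsto_integral_filter_of_dominated_convergence (fun _ => 2)
        (Eventually.of_forall fun η => (hcont η).aestronglyMeasurable)
        (Eventually.of_forall fun η => Eventually.of_forall (hbd η)) (integrable_const _)
        (Eventually.of_forall fun s => ?_)
      have hc : Continuous fun η : ℝ => min 2 (2 * |η| * ‖s‖ * ‖t‖) := by fun_prop
      have := (hc.tendsto 0).mono_left (nhdsWithin_le_nhds (s := Set.Ioi 0))
      simpa [φ] using this
    simpa using this
  suffices hd : Tendsto (fun n => ∫ x, Complex.exp (inner ℝ (V n x) t * Complex.I) ∂(P n)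
      - ∫ x, Complex.exp (inner ℝ (S n x) t * Complex.I) ∂(P n)) atTop (𝓝 0) by
    simpa using hd.add (h t)
  have hbound : ∀ η : ℝ, 0 < η → η ≤ 1 / 2 → ∀ n,
      ‖∫ x, Complex.exp (inner ℝ (V n x) t * Complex.I) ∂(P n)
        - ∫ x, Complex.exp (inner ℝ (S n x) t * Complex.I) ∂(P n)‖
      ≤ 2 * (P n {x | ¬ ‖V n x - S n x‖ ≤ η * ‖V n x‖}).toReal + ∫ x, φ η (S n x) ∂(P n) := by
    intro η hη hη2 n
    -- The exceptional set need not be measurable; its measurable hull has the same measure.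
    set B := toMeasurable (P n) {x | ¬ ‖V n x - S n x‖ ≤ η * ‖V n x‖} with hB
    have hBm : MeasurableSet B := measurableSet_toMeasurable _ _
    have i1 : Integrable (B.indicator fun _ => (2 : ℝ)) (P n) :=
      (integrable_const _).indicator hBm
    have i2 : Integrable (fun x => φ η (S n x)) (P n) :=
      (integrable_const (2 : ℝ)).mono' ((hcont η).comp_aestronglyMeasurable
        (hS n).aestronglyMeasurable) (Eventually.of_forall fun x => hbd η _)
    have e1 : ∫ x, B.indicator (fun _ => (2 : ℝ)) x ∂(P n)
        = 2 * (P n {x | ¬ ‖V n x - S n x‖ ≤ η * ‖V n x‖}).toReal := by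
      rw [integral_indicator_const _ hBm, Measure.real, hB, measure_toMeasurable, smul_eq_mul,
        mul_comm]
    rw [← integral_sub (hexp hV n) (hexp hS n), ← e1, ← integral_add i1 i2]
    refine norm_integral_le_of_norm_le (i1.add i2) (Eventually.of_forall fun x => ?_)
    refine (norm_exp_inner_sub_le _ _ _).trans ?_
    have hφn : 0 ≤ φ η (S n x) := le_min (by norm_num) (by positivity)
    by_cases hx : x ∈ B
    · simp only [Set.indicator_of_mem hx]
      linarith [min_le_left 2 (‖V n x - S n x‖ * ‖t‖)]
    · have hx' : ‖V n x - S n x‖ ≤ η * ‖V n x‖ := by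
        by_contra hc
        exact hx (subset_toMeasurable _ _ hc)
      simp only [Set.indicator_of_notMem hx, zero_add]
      change _ ≤ min 2 (2 * |η| * ‖S n x‖ * ‖t‖)
      refine min_le_min le_rfl (mul_le_mul_of_nonneg_right ?_ (norm_nonneg t))
      have h1 : ‖V n x‖ ≤ ‖V n x - S n x‖ + ‖S n x‖ := by
        simpa using norm_add_le (V n x - S n x) (S n x)
      -- Absorption: `η ≤ 1 / 2` turns an error relative to `V n` into one relative to `S n`, whose
      -- law is under control.
      have h2 : ‖V n x‖ ≤ 2 * ‖S n x‖ := by nlinarith [norm_nonneg (V n x)]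
      rw [abs_of_pos hη]
      nlinarith
  rw [NormedAddGroup.tendsto_nhds_zero]
  intro ε hε
  obtain ⟨η, hη1, hη0, hη2⟩ := ((hφ0.eventually (gt_mem_nhds (half_pos hε))).and
    (Ioc_mem_nhdsGT (show (0 : ℝ) < 1 / 2 by norm_num))).exists
  have hlim1 := tendsto_integral_of_tendsto_charFun P hS N h (φ η)
  have hlim2 : Tendsto (fun n => 2 * (P n {x | ¬ ‖V n x - S n x‖ ≤ η * ‖V n x‖}).toReal) atTop
      (𝓝 0) := by
    simpa using ((ENNReal.tendsto_toReal ENNReal.zero_ne_top).comp (herr η hη0)).const_mul 2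
  filter_upwards [hlim1.eventually (gt_mem_nhds hη1),
    hlim2.eventually (gt_mem_nhds (half_pos hε))] with n h1 h2
  linarith [hbound η hη0 hη2 n]

end Slutsky

/-! ### Contiguity and negligible events -/

/-- Contiguity transfers vanishing outer measure. -/
theorem IsContiguous.tendsto {Ω : ℕ → Type*} [∀ n, MeasurableSpace (Ω n)]
    {Q P : (n : ℕ) → Measure (Ω n)} (h : IsContiguous Q P) {A : (n : ℕ) → Set (Ω n)}
    (hA : Tendsto (fun n => P n (A n)) atTop (𝓝 0)) :
    Tendsto (fun n => Q n (A n)) atTop (𝓝 0) := by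
  have h1 := h (fun n => toMeasurable (P n) (A n)) (fun n => measurableSet_toMeasurable _ _)
    (by simpa only [measure_toMeasurable] using hA)
  exact tendsto_of_tendsto_of_tendsto_of_le_of_le tendsto_const_nhds h1 (fun _ => zero_le)
    (fun _ => measure_mono (subset_toMeasurable _ _))

theorem tendsto_measure_union_zero {Ω : ℕ → Type*} [∀ n, MeasurableSpace (Ω n)]
    {P : (n : ℕ) → Measure (Ω n)} {A B : (n : ℕ) → Set (Ω n)}
    (hA : Tendsto (fun n => P n (A n)) atTop (𝓝 0))
    (hB : Tendsto (fun n => P n (B n)) atTop (𝓝 0)) :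
    Tendsto (fun n => P n (A n ∪ B n)) atTop (𝓝 0) :=
  tendsto_of_tendsto_of_tendsto_of_le_of_le tendsto_const_nhds (by simpa using hA.add hB)
    (fun _ => zero_le) (fun _ => measure_union_le _ _)

theorem tendsto_measure_zero_of_subset {Ω : ℕ → Type*} [∀ n, MeasurableSpace (Ω n)]
    {P : (n : ℕ) → Measure (Ω n)} {A B : (n : ℕ) → Set (Ω n)}
    (hB : Tendsto (fun n => P n (B n)) atTop (𝓝 0)) (h : ∀ᶠ n in atTop, A n ⊆ B n) :
    Tendsto (fun n => P n (A n)) atTop (𝓝 0) :=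
  tendsto_of_tendsto_of_tendsto_of_le_of_le' tendsto_const_nhds hB
    (Eventually.of_forall fun _ => zero_le) (h.mono fun _ hn => measure_mono hn)

/-- The fixed point is the pointwise limit of the iterates from a constant starting point, and each
iterate is jointly built from measurable maps. -/
theorem measurable_fixedPoint {Ω ι : Type*} [MeasurableSpace Ω] [MetricSpace ι] [CompleteSpace ι]
    [Nonempty ι] [MeasurableSpace ι] [BorelSpace ι] {K : NNReal} {Φ : Ω → ι → ι}
    (hΦ : ∀ w, ContractingWith K (Φ w)) (hm : Measurable (Function.uncurry Φ)) :
    Measurable fun w => ContractingWith.fixedPoint (Φ w) (hΦ w) := by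
  obtain ⟨x₀⟩ := ‹Nonempty ι›
  have hit : ∀ k : ℕ, Measurable fun w => (Φ w)^[k] x₀ := by
    intro k
    induction k with
    | zero => exact measurable_const
    | succ k ih =>
      simp_rw [Function.iterate_succ_apply']
      exact hm.comp (measurable_id.prodMk ih)
  refine measurable_of_tendsto_metrizable hit ?_
  rw [tendsto_pi_nhds]
  exact fun w => (hΦ w).tendsto_iterate_fixedPoint x₀

/-! ### Roots of general estimating equations -/

section Estimating

variable {𝓧 : Type*} [MeasurableSpace 𝓧] {E : Type*} [NormedAddCommGroup E] [NormedSpace ℝ E]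

/-- The empirical mean of `ψ θ` over a sample. -/
noncomputable def sampleMean (ψ : E → 𝓧 → E) {n : ℕ} (X : Fin n → 𝓧) (θ : E) : E :=
  (n : ℝ)⁻¹ • ∑ i, ψ θ (X i)

/-- An estimating function `ψ`, centred at `θ₀` under `P`, whose derivative in `θ` has mean `-J`
and is Lipschitz in `θ` near `θ₀` with an integrable Lipschitz constant. -/
structure RegularEstimatingFunction (P : Measure 𝓧) (G : Set 𝓧) (θ₀ : E) (r : ℝ)
    (ψ : E → 𝓧 → E) (ψ' : 𝓧 → E →L[ℝ] E) (M : 𝓧 → ℝ) (J : E →L[ℝ] E) : Prop where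
  pos : 0 < r
  ae_mem : ∀ᵐ x ∂P, x ∈ G
  linearize : ∀ x ∈ G, ∀ ρ ≤ r, ∀ a ∈ Metric.closedBall θ₀ ρ, ∀ b ∈ Metric.closedBall θ₀ ρ,
    ‖ψ a x - ψ b x - ψ' x (a - b)‖ ≤ M x * ρ * ‖a - b‖
  integrable_deriv : Integrable ψ' P
  integral_deriv : ∫ x, ψ' x ∂P = -J
  integrable_bound : Integrable M P
  integrable : Integrable (ψ θ₀) P
  integral_eq_zero : ∫ x, ψ θ₀ x ∂P = 0

namespace RegularEstimatingFunction

variable {P : Measure 𝓧} [IsProbabilityMeasure P] {G : Set 𝓧} {θ₀ : E} {r : ℝ}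
    {ψ : E → 𝓧 → E} {ψ' : 𝓧 → E →L[ℝ] E} {M : 𝓧 → ℝ} {J : E →L[ℝ] E}

theorem tendsto_not_mem (h : RegularEstimatingFunction P G θ₀ r ψ ψ' M J) :
    Tendsto (fun n => (Measure.pi fun _ : Fin n => P) {X | ¬ ∀ i, X i ∈ G}) atTop (𝓝 0) :=
  tendsto_const_nhds.congr fun n => (ae_iff.1 (ae_pi_forall h.ae_mem n)).symm

/-- With probability tending to one, the estimating function is uniformly almost linear near
`θ₀`. -/
theorem exists_linearization [CompleteSpace E] (h : RegularEstimatingFunction P G θ₀ r ψ ψ' M J) {η : ℝ}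
    (hη : 0 < η) : ∃ ρ, 0 < ρ ∧ ρ ≤ r ∧
      Tendsto (fun n => (Measure.pi fun _ : Fin n => P) {X | ¬ ∀ a ∈ Metric.closedBall θ₀ ρ,
        ∀ b ∈ Metric.closedBall θ₀ ρ,
        ‖sampleMean ψ X a - sampleMean ψ X b + J (a - b)‖ ≤ η * ‖a - b‖}) atTop (𝓝 0) := by
  set m := |∫ x, M x ∂P| + 1 with hm
  have hm0 : 0 < m := by positivity
  -- The error splits into two halves. The averaged derivative is within $\eta/2$ of $-J$; the
  -- Lipschitz part is at most $\rho m\le\eta/2$, where $m=|\int M|+1$ bounds the empirical mean of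
  -- `M` with probability tending to one.
  refine ⟨min r (η / (2 * m)), lt_min h.pos (by positivity), min_le_left _ _, ?_⟩
  set ρ := min r (η / (2 * m)) with hρ
  have hρ0 : 0 < ρ := lt_min h.pos (by positivity)
  have hρm : ρ * m ≤ η / 2 := by
    have : ρ ≤ η / (2 * m) := min_le_right _ _
    rw [le_div_iff₀ (by positivity)] at this
    linarith
  refine tendsto_measure_zero_of_subset (tendsto_measure_union_zero h.tendsto_not_mem
    (tendsto_measure_union_zero (weak_law P h.integrable_deriv (half_pos hη))
    (weak_law P h.integrable_bound one_pos))) ((eventually_ge_atTop 1).mono fun n hn X hX => ?_)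
  by_contra hc
  simp only [Set.mem_union, Set.mem_ofPred_eq, not_or, not_le, not_not] at hc
  obtain ⟨hG, hd, hM⟩ := hc
  refine hX fun a ha b hb => ?_
  rw [h.integral_deriv, sub_neg_eq_add] at hd
  have hM' : (n : ℝ)⁻¹ * ∑ i, M (X i) ≤ m := by
    rw [Real.norm_eq_abs, smul_eq_mul] at hM
    have := (abs_lt.1 hM).2
    linarith [le_abs_self (∫ x, M x ∂P)]
  have hdec : sampleMean ψ X a - sampleMean ψ X b + J (a - b)
      = (n : ℝ)⁻¹ • ∑ i, (ψ a (X i) - ψ b (X i) - ψ' (X i) (a - b))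
        + ((n : ℝ)⁻¹ • ∑ i, ψ' (X i) + J) (a - b) := by
    simp only [sampleMean, Finset.sum_sub_distrib, smul_sub, add_apply,
      smul_apply, sum_apply]
    abel
  rw [hdec]
  have h1 : ‖(n : ℝ)⁻¹ • ∑ i, (ψ a (X i) - ψ b (X i) - ψ' (X i) (a - b))‖
      ≤ ρ * m * ‖a - b‖ := by
    rw [norm_smul, Real.norm_of_nonneg (by positivity)]
    calc (n : ℝ)⁻¹ * ‖∑ i, (ψ a (X i) - ψ b (X i) - ψ' (X i) (a - b))‖
        ≤ (n : ℝ)⁻¹ * ∑ i, M (X i) * ρ * ‖a - b‖ := by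
          refine mul_le_mul_of_nonneg_left (norm_sum_le_of_le _ fun i _ => ?_) (by positivity)
          exact h.linearize _ (hG i) ρ (min_le_left _ _) a ha b hb
      _ = ((n : ℝ)⁻¹ * ∑ i, M (X i)) * (ρ * ‖a - b‖) := by
          rw [← Finset.sum_mul, ← Finset.sum_mul]; ring
      _ ≤ m * (ρ * ‖a - b‖) := mul_le_mul_of_nonneg_right hM' (by positivity)
      _ = ρ * m * ‖a - b‖ := by ring
  have h2 := ContinuousLinearMap.le_of_opNorm_le _ hd.le (a - b)
  refine (norm_add_le _ _).trans ((add_le_add h1 h2).trans ?_)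
  nlinarith [norm_nonneg (a - b)]

/-- A consistent root of the estimating equation is asymptotically linear, with an error that is
relatively small; `θ n` is any sequence of centring values tending to `θ₀`. -/
theorem tendsto_relative_error [CompleteSpace E] (h : RegularEstimatingFunction P G θ₀ r ψ ψ' M J)
    {A A' J' : E →L[ℝ] E} (hJ : ∀ v, J' (J v) = v) (hA : ∀ v, A' (A v) = v)
    {θ : ℕ → E} (hθ : Tendsto θ atTop (𝓝 θ₀)) {T : (n : ℕ) → (Fin n → 𝓧) → E}
    (hroot : Tendsto (fun n => (Measure.pi fun _ : Fin n => P)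
      {X | ¬ sampleMean ψ X (T n X) = 0}) atTop (𝓝 0))
    (hcons : ∀ ε > 0, Tendsto (fun n => (Measure.pi fun _ : Fin n => P)
      {X | ε ≤ dist (T n X) θ₀}) atTop (𝓝 0)) {η : ℝ} (hη : 0 < η) :
    Tendsto (fun n : ℕ => (Measure.pi fun _ : Fin n => P)
      {X | ¬ ‖A (Real.sqrt n • (T n X - θ n)) - A (J' (Real.sqrt n • sampleMean ψ X (θ n)))‖
        ≤ η * ‖A (Real.sqrt n • (T n X - θ n))‖}) atTop (𝓝 0) := by
  -- This constant converts the linearization error, measured by $\|T_n-\theta_n\|$, into one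
  -- measured by the image under `A`; the added 1 only keeps it positive.
  set c := ‖A‖ * ‖J'‖ * ‖A'‖ + 1 with hc
  have hc0 : 0 < c := by positivity
  obtain ⟨ρ, hρ, -, hlin⟩ := h.exists_linearization (div_pos hη hc0)
  refine tendsto_measure_zero_of_subset (tendsto_measure_union_zero hlin
    (tendsto_measure_union_zero hroot (hcons ρ hρ))) ?_
  filter_upwards [hθ.eventually (Metric.closedBall_mem_nhds θ₀ hρ)] with n hn X hX
  by_contra hcon
  simp only [Set.mem_union, Set.mem_ofPred_eq, not_or, not_le, not_not] at hcon
  obtain ⟨hl, h0, hT⟩ := hcon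
  refine hX ?_
  have hl' := hl (T n X) (Metric.mem_closedBall.2 hT.le) (θ n) hn
  rw [h0, zero_sub] at hl'
  set v := T n X - θ n with hv
  have hs : 0 ≤ Real.sqrt n := Real.sqrt_nonneg _
  -- Since the empirical mean vanishes at `T n X`, the error is exactly the image of the
  -- linearization error between `T n X` and `θ n`.
  have e1 : A (Real.sqrt n • v) - A (J' (Real.sqrt n • sampleMean ψ X (θ n)))
      = Real.sqrt n • A (J' (-sampleMean ψ X (θ n) + J v)) := by
    simp only [map_smul, map_add, map_neg, hJ, smul_add, smul_neg]
    abel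
  rw [e1, norm_smul, map_smul, norm_smul, Real.norm_of_nonneg hs, ← mul_assoc, mul_comm η, mul_assoc]
  refine mul_le_mul_of_nonneg_left ?_ hs
  have hvA : ‖v‖ ≤ ‖A'‖ * ‖A v‖ := by simpa [hA] using A'.le_opNorm (A v)
  calc ‖A (J' (-sampleMean ψ X (θ n) + J v))‖
      ≤ ‖A‖ * (‖J'‖ * ‖-sampleMean ψ X (θ n) + J v‖) :=
        (A.le_opNorm _).trans (mul_le_mul_of_nonneg_left (J'.le_opNorm _) (norm_nonneg _))
    _ ≤ ‖A‖ * (‖J'‖ * (η / c * (‖A'‖ * ‖A v‖))) := by gcongr; exact hl'.trans (by gcongr)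
    _ = (‖A‖ * ‖J'‖ * ‖A'‖) * (η / c) * ‖A v‖ := by ring
    _ ≤ c * (η / c) * ‖A v‖ := by gcongr; linarith
    _ = η * ‖A v‖ := by field_simp

/-- The estimating equation has a measurable and consistent sequence of roots. -/
theorem exists_consistent_root [CompleteSpace E] [MeasurableSpace E] [BorelSpace E] [SecondCountableTopology E]
    (h : RegularEstimatingFunction P G θ₀ r ψ ψ' M J) {J' : E →L[ℝ] E}
    (hJ : ∀ v, J' (J v) = v) (hJ' : ∀ v, J (J' v) = v)
    (hψ : ∀ θ ∈ Metric.closedBall θ₀ r, Measurable (G.indicator (ψ θ))) :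
    ∃ T : (n : ℕ) → (Fin n → 𝓧) → E, (∀ n, Measurable (T n)) ∧
      (∀ n X, T n X ∈ Metric.closedBall θ₀ r) ∧
      Tendsto (fun n => (Measure.pi fun _ : Fin n => P)
        {X | ¬ sampleMean ψ X (T n X) = 0}) atTop (𝓝 0) ∧
      ∀ ε > 0, Tendsto (fun n => (Measure.pi fun _ : Fin n => P)
        {X | ε ≤ dist (T n X) θ₀}) atTop (𝓝 0) := by
  set c := ‖J'‖ + 1 with hc
  have hc0 : 0 < c := by positivity
  have hJc : ∀ v, ‖J' v‖ ≤ c * ‖v‖ := fun v => (J'.le_opNorm v).trans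
    (mul_le_mul_of_nonneg_right (by linarith) (norm_nonneg v))
  -- Slope $1/(2c)$ with $\|J'\|\le c$ gives the contraction constant $1/2$ below; then
  -- $\|\bar\psi(\theta_0)\|<\rho/(2c)$ moves the centre by at most $\rho/2$, so the ball is mapped
  -- into itself.
  obtain ⟨ρ, hρ, hρr, hlin⟩ := h.exists_linearization (η := 1 / (2 * c)) (by positivity)
  have hwl : ∀ ε > 0, Tendsto (fun n : ℕ => (Measure.pi fun _ : Fin n => P)
      {X | ε ≤ ‖sampleMean ψ X θ₀‖}) atTop (𝓝 0) := fun ε hε => by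
    simpa [h.integral_eq_zero, sampleMean] using weak_law P h.integrable hε
  set Bad : (n : ℕ) → Set (Fin n → 𝓧) := fun n => {X | ¬ ∀ i, X i ∈ G} ∪
    ({X | ρ / (2 * c) ≤ ‖sampleMean ψ X θ₀‖} ∪ {X | ¬ ∀ a ∈ Metric.closedBall θ₀ ρ,
        ∀ b ∈ Metric.closedBall θ₀ ρ,
        ‖sampleMean ψ X a - sampleMean ψ X b + J (a - b)‖ ≤ 1 / (2 * c) * ‖a - b‖}) with hBad
  have hBadlim : Tendsto (fun n => (Measure.pi fun _ : Fin n => P) (Bad n)) atTop (𝓝 0) :=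
    tendsto_measure_union_zero h.tendsto_not_mem
      (tendsto_measure_union_zero (hwl _ (by positivity)) hlin)
  -- A measurable set of good samples, needed for a measurable definition by cases.
  set A : (n : ℕ) → Set (Fin n → 𝓧) := fun n =>
    (toMeasurable (Measure.pi fun _ : Fin n => P) (Bad n))ᶜ with hA
  have hAm : ∀ n, MeasurableSet (A n) := fun n => (measurableSet_toMeasurable _ _).compl
  have hAlim : Tendsto (fun n => (Measure.pi fun _ : Fin n => P) (A n)ᶜ) atTop (𝓝 0) := by
    simpa only [hA, compl_compl, measure_toMeasurable] using hBadlim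
  have hAmem : ∀ n, ∀ X ∈ A n, (∀ i, X i ∈ G) ∧ ‖sampleMean ψ X θ₀‖ < ρ / (2 * c) ∧
      ∀ a ∈ Metric.closedBall θ₀ ρ, ∀ b ∈ Metric.closedBall θ₀ ρ,
        ‖sampleMean ψ X a - sampleMean ψ X b + J (a - b)‖ ≤ 1 / (2 * c) * ‖a - b‖ := by
    intro n X hX
    have : X ∉ Bad n := fun hb => hX (subset_toMeasurable _ _ hb)
    simpa [hBad, not_or] using this
  -- A Newton step with the derivative frozen at its mean $-J$; as `J'` is injective, fixed points
  -- are exactly the roots.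
  set F : (n : ℕ) → (Fin n → 𝓧) → E → E := fun n X θ => θ + J' (sampleMean ψ X θ) with hF
  have hθ₀ : θ₀ ∈ Metric.closedBall θ₀ ρ := Metric.mem_closedBall_self hρ.le
  have hFlip : ∀ n, ∀ X ∈ A n, ∀ a ∈ Metric.closedBall θ₀ ρ, ∀ b ∈ Metric.closedBall θ₀ ρ,
      ‖F n X a - F n X b‖ ≤ 1 / 2 * ‖a - b‖ := by
    intro n X hX a ha b hb
    have e1 : F n X a - F n X b = J' (sampleMean ψ X a - sampleMean ψ X b + J (a - b)) := by
      simp only [hF, map_add, map_sub, hJ]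
      abel
    rw [e1]
    refine (hJc _).trans ((mul_le_mul_of_nonneg_left ((hAmem n X hX).2.2 a ha b hb) hc0.le).trans
      (le_of_eq ?_))
    field_simp
  have hF0 : ∀ n X, ‖F n X θ₀ - θ₀‖ ≤ c * ‖sampleMean ψ X θ₀‖ := fun n X => by
    simpa [hF] using hJc (sampleMean ψ X θ₀)
  have hFmem : ∀ n, ∀ X ∈ A n, ∀ a ∈ Metric.closedBall θ₀ ρ, F n X a ∈ Metric.closedBall θ₀ ρ := by
    intro n X hX a ha
    rw [mem_closedBall_iff_norm] at ha ⊢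
    have h1 := hFlip n X hX a (mem_closedBall_iff_norm.2 ha) θ₀ hθ₀
    have h2 : ‖F n X θ₀ - θ₀‖ ≤ ρ / 2 := by
      refine (hF0 n X).trans ((mul_le_mul_of_nonneg_left (hAmem n X hX).2.1.le hc0.le).trans
        (le_of_eq ?_))
      field_simp
    have h3 : ‖F n X a - θ₀‖ ≤ ‖F n X a - F n X θ₀‖ + ‖F n X θ₀ - θ₀‖ := norm_sub_le_norm_sub_add_norm_sub ..
    linarith
  classical
  -- Off the good samples the map is constant, so it is a contraction for every sample and its fixed
  -- point is defined everywhere.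
  let Φ : (n : ℕ) → (Fin n → 𝓧) → Metric.closedBall θ₀ ρ → Metric.closedBall θ₀ ρ :=
    fun n X θ => ⟨if X ∈ A n then F n X θ else θ₀, by
      split_ifs with hX
      · exact hFmem n X hX θ θ.2
      · exact hθ₀⟩
  have hΦ : ∀ n X, ContractingWith (1 / 2) (Φ n X) := by
    intro n X
    refine ⟨by norm_num, LipschitzWith.of_dist_le_mul fun a b => ?_⟩
    rw [Subtype.dist_eq, Subtype.dist_eq, dist_eq_norm, dist_eq_norm]
    simp only [Φ]
    split_ifs with hX
    · simpa using hFlip n X hX a a.2 b b.2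
    · simp
  have hΦm : ∀ n, Measurable (Function.uncurry (Φ n)) := by
    intro n
    have hc1 : ∀ X, Continuous fun θ => Φ n X θ := fun X => (hΦ n X).2.continuous
    have hc2 : ∀ θ, Measurable fun X => Φ n X θ := by
      intro θ
      refine Measurable.subtype_mk ?_
      have hm : Measurable fun X : Fin n → 𝓧 =>
          (θ : E) + J' (sampleMean (fun θ => G.indicator (ψ θ)) X θ) := by
        have : Measurable fun X : Fin n → 𝓧 => sampleMean (fun θ => G.indicator (ψ θ)) X (θ : E) :=
          (Finset.measurable_sum _ fun i _ => (hψ θ (Metric.closedBall_subset_closedBall hρr θ.2)).comp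
            (measurable_pi_apply i)).const_smul _
        exact (J'.continuous.measurable.comp this).const_add _
      have heq : (fun X : Fin n → 𝓧 => if X ∈ A n then F n X θ else θ₀) = fun X =>
          if X ∈ A n then (θ : E) + J' (sampleMean (fun θ => G.indicator (ψ θ)) X θ) else θ₀ := by
        funext X
        split_ifs with hX
        · simp [hF, sampleMean, (hAmem n X hX).1]
        · rfl
      rw [heq]
      exact Measurable.ite (hAm n) hm measurable_const
    -- Carathéodory argument: continuous in the parameter and measurable in the sample gives joint
    -- measurability.
    have := (stronglyMeasurable_uncurry_of_continuous_of_stronglyMeasurable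
      (u := fun θ X => Φ n X θ) hc1 fun θ => (hc2 θ).stronglyMeasurable).measurable
    exact this.comp measurable_swap
  have : CompleteSpace (Metric.closedBall θ₀ ρ) :=
    (Metric.isClosed_closedBall (x := θ₀) (ε := ρ)).completeSpace_coe
  have : Nonempty (Metric.closedBall θ₀ ρ) := ⟨⟨θ₀, hθ₀⟩⟩
  set T : (n : ℕ) → (Fin n → 𝓧) → Metric.closedBall θ₀ ρ :=
    fun n X => ContractingWith.fixedPoint (Φ n X) (hΦ n X) with hT
  have hTfix : ∀ n, ∀ X ∈ A n, F n X (T n X) = T n X := by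
    intro n X hX
    have h1 : Φ n X (T n X) = T n X := (hΦ n X).fixedPoint_isFixedPt
    have h2 := congrArg Subtype.val h1
    simpa [Φ, hX] using h2
  refine ⟨fun n X => T n X, fun n => measurable_subtype_coe.comp (measurable_fixedPoint (hΦ n) (hΦm n)),
    fun n X => Metric.closedBall_subset_closedBall hρr (T n X).2, ?_, fun ε hε => ?_⟩
  · refine tendsto_measure_zero_of_subset hAlim (Eventually.of_forall fun n X hX hXA => hX ?_)
    have h1 : J' (sampleMean ψ X (T n X)) = 0 := by
      have := hTfix n X hXA
      simpa [hF] using this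
    rw [← hJ' (sampleMean ψ X (T n X)), h1, map_zero]
  · refine tendsto_measure_zero_of_subset (tendsto_measure_union_zero hAlim
      (hwl (ε / (2 * c)) (by positivity))) (Eventually.of_forall fun n X hX => ?_)
    by_contra hcon
    simp only [Set.mem_union, Set.mem_compl_iff, Set.mem_ofPred_eq, not_or, not_not, not_le] at hcon
    obtain ⟨hXA, hsm⟩ := hcon
    -- Contraction from `T n X` to `θ₀` gives
    -- $\|T_n-\theta_0\|\le\frac12\|T_n-\theta_0\|+c\|\bar\psi(\theta_0)\|$, so consistency follows
    -- from the law of large numbers at `θ₀`.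
    have h1 := hFlip n X hXA (T n X) (T n X).2 θ₀ hθ₀
    rw [hTfix n X hXA] at h1
    have h2 : ‖(T n X : E) - θ₀‖ ≤ ‖(T n X : E) - F n X θ₀‖ + ‖F n X θ₀ - θ₀‖ :=
      norm_sub_le_norm_sub_add_norm_sub ..
    have h3 := hF0 n X
    have h4 : c * ‖sampleMean ψ X θ₀‖ < ε / 2 := by
      refine (mul_lt_mul_of_pos_left hsm hc0).trans_eq ?_
      field_simp
    have h5 : ε ≤ ‖(T n X : E) - θ₀‖ := by simpa [dist_eq_norm] using hX
    linarith

end RegularEstimatingFunction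

end Estimating

/-! ### Derivatives of powers and logarithms -/

section Calculus

variable {E : Type*} [NormedAddCommGroup E] [NormedSpace ℝ E]

theorem iteratedFDeriv_three_apply {F : Type*} [NormedAddCommGroup F] [NormedSpace ℝ F]
    (h : E → F) (θ : E) (u v w : E) :
    iteratedFDeriv ℝ 3 h θ ![u, v, w] = fderiv ℝ (fderiv ℝ (fderiv ℝ h)) θ u v w := by
  rw [iteratedFDeriv_succ_apply_right, iteratedFDeriv_two_apply]
  rfl

theorem iteratedFDeriv_two_apply' {F : Type*} [NormedAddCommGroup F] [NormedSpace ℝ F]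
    (h : E → F) (θ : E) (u v : E) :
    iteratedFDeriv ℝ 2 h θ ![u, v] = fderiv ℝ (fderiv ℝ h) θ u v := by
  rw [iteratedFDeriv_two_apply]
  rfl

variable {g : E → ℝ} {U : Set E}

theorem contDiffOn_fderiv {F : Type*} [NormedAddCommGroup F] [NormedSpace ℝ F] {h : E → F}
    (hU : IsOpen U) {n : ℕ} (hh : ContDiffOn ℝ (n + 1 : ℕ) h U) :
    ContDiffOn ℝ n (fderiv ℝ h) U :=
  hh.fderiv_of_isOpen hU (by norm_cast)

/-- The chain rule combined with $Dg=g\,D\log g$. Expressing powers through the logarithm puts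
$\beta=0$ and $\beta>0$ on the same footing. -/
theorem fderiv_rpow_const_eq (hU : IsOpen U) (hg : ContDiffOn ℝ 3 g U) (hpos : ∀ η ∈ U, 0 < g η)
    (a : ℝ) {θ : E} (hθ : θ ∈ U) :
    fderiv ℝ (fun η => g η ^ a) θ = (a * g θ ^ a) • fderiv ℝ (fun η => Real.log (g η)) θ := by
  have hd : DifferentiableAt ℝ g θ := (hg.differentiableOn (by norm_num)).differentiableAt
    (hU.mem_nhds hθ)
  have h0 := hpos θ hθ
  rw [(hd.hasFDerivAt.rpow_const (Or.inl h0.ne')).fderiv, (hd.hasFDerivAt.log h0.ne').fderiv,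
    smul_smul, Real.rpow_sub_one h0.ne']
  congr 1
  field_simp

theorem contDiffOn_log (hg : ContDiffOn ℝ 3 g U) (hpos : ∀ η ∈ U, 0 < g η) :
    ContDiffOn ℝ 3 (fun η => Real.log (g η)) U :=
  hg.log fun η hη => (hpos η hη).ne'

theorem contDiffOn_rpow_const (hg : ContDiffOn ℝ 3 g U) (hpos : ∀ η ∈ U, 0 < g η) (a : ℝ) :
    ContDiffOn ℝ 3 (fun η => g η ^ a) U :=
  fun η hη => (hg η hη).rpow_const_of_ne (hpos η hη).ne'

theorem fderiv_fderiv_rpow_const_apply (hU : IsOpen U) (hg : ContDiffOn ℝ 3 g U)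
    (hpos : ∀ η ∈ U, 0 < g η) (a : ℝ) {θ : E} (hθ : θ ∈ U) (v w : E) :
    fderiv ℝ (fderiv ℝ fun η => g η ^ a) θ v w
      = g θ ^ a * (a * fderiv ℝ (fderiv ℝ fun η => Real.log (g η)) θ v w
        + a ^ 2 * (fderiv ℝ (fun η => Real.log (g η)) θ v
          * fderiv ℝ (fun η => Real.log (g η)) θ w)) := by
  have hnhds := hU.mem_nhds hθ
  have heq : (fderiv ℝ fun η => g η ^ a) =ᶠ[𝓝 θ]
      fun η => (a * g η ^ a) • fderiv ℝ (fun η => Real.log (g η)) η := by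
    filter_upwards [hnhds] with η hη
    exact fderiv_rpow_const_eq hU hg hpos a hη
  have h1 : DifferentiableAt ℝ (fun η => g η ^ a) θ :=
    ((contDiffOn_rpow_const hg hpos a).differentiableOn (by norm_num)).differentiableAt hnhds
  have h2 : DifferentiableAt ℝ (fderiv ℝ fun η => Real.log (g η)) θ :=
    ((contDiffOn_fderiv (n := 2) hU (contDiffOn_log hg hpos)).differentiableOn
      (by norm_num)).differentiableAt hnhds
  have h3 : HasFDerivAt (fun η => (a * g η ^ a) • fderiv ℝ (fun η => Real.log (g η)) η) _ θ :=
    (h1.hasFDerivAt.const_mul a).smul h2.hasFDerivAt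
  rw [heq.fderiv_eq, h3.fderiv, fderiv_rpow_const_eq hU hg hpos a hθ]
  simp
  ring

end Calculus

/-! ### Multilinear maps in coordinates -/

section Basis

variable {E : Type*} [NormedAddCommGroup E] [InnerProductSpace ℝ E] {ι : Type*} [Fintype ι]
  (b : OrthonormalBasis ι ℝ E) {F : Type*} [NormedAddCommGroup F] [NormedSpace ℝ F]

theorem apply_eq_sum_basis (L : E →L[ℝ] F) (v : E) : L v = ∑ i, inner ℝ (b i) v • L (b i) := by
  conv_lhs => rw [← b.sum_repr' v]
  simp

theorem eq_sum_smulRight_basis (L : E →L[ℝ] F) :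
    L = ∑ i, ContinuousLinearMap.smulRightL ℝ E F (innerSL ℝ (b i)) (L (b i)) := by
  ext v
  rw [apply_eq_sum_basis b L v]
  simp [sum_apply]

/-- Expand all three arguments in the orthonormal basis and bound each coordinate by the norm. This
turns the coordinatewise condition D5 into an operator norm bound. -/
theorem norm_le_sum_of_basis_bound (B : E →L[ℝ] E →L[ℝ] E →L[ℝ] ℝ) {c : ι → ι → ι → ℝ}
    (h : ∀ j k l, |B (b j) (b k) (b l)| ≤ c j k l) :
    ‖B‖ ≤ ∑ j, ∑ k, ∑ l, c j k l := by
  have hc : ∀ j k l, 0 ≤ c j k l := fun j k l => (abs_nonneg _).trans (h j k l)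
  have hc0 : 0 ≤ ∑ j, ∑ k, ∑ l, c j k l :=
    Finset.sum_nonneg fun j _ => Finset.sum_nonneg fun k _ => Finset.sum_nonneg fun l _ => hc j k l
  have hcoord : ∀ (v : E) j, |inner ℝ (b j) v| ≤ ‖v‖ := fun v j => by
    simpa using norm_inner_le_norm (𝕜 := ℝ) (b j) v
  refine B.opNorm_le_bound hc0 fun u => ?_
  refine (B u).opNorm_le_bound (by positivity) fun v => ?_
  refine (B u v).opNorm_le_bound (by positivity) fun w => ?_
  have e : B u v w = ∑ j, ∑ k, ∑ l,
      inner ℝ (b j) u * (inner ℝ (b k) v * (inner ℝ (b l) w * B (b j) (b k) (b l))) := by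
    rw [apply_eq_sum_basis b B u]
    simp only [sum_apply, smul_apply, smul_eq_mul]
    refine Finset.sum_congr rfl fun j _ => ?_
    rw [apply_eq_sum_basis b (B (b j)) v]
    simp only [sum_apply, smul_apply, smul_eq_mul, Finset.mul_sum]
    refine Finset.sum_congr rfl fun k _ => ?_
    rw [apply_eq_sum_basis b (B (b j) (b k)) w]
    simp only [smul_eq_mul, Finset.mul_sum]
  have e2 : (∑ j, ∑ k, ∑ l, c j k l) * ‖u‖ * ‖v‖ * ‖w‖
      = ∑ j, ∑ k, ∑ l, ‖u‖ * (‖v‖ * (‖w‖ * c j k l)) := by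
    simp only [← Finset.mul_sum]
    ring
  rw [e, e2]
  refine norm_sum_le_of_le _ fun j _ => norm_sum_le_of_le _ fun k _ =>
    norm_sum_le_of_le _ fun l _ => ?_
  rw [norm_mul, norm_mul, norm_mul]
  gcongr
  · exact hcoord u j
  · exact hcoord v k
  · exact hcoord w l
  · exact h j k l

/-- Integrability of an operator valued function can be checked on a basis. -/
theorem integrable_of_basis {𝓧 : Type*} [MeasurableSpace 𝓧] {P : Measure 𝓧} {B : 𝓧 → E →L[ℝ] F}
    (h : ∀ i, Integrable (fun x => B x (b i)) P) : Integrable B P := by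
  rw [show B = fun x => ∑ i, ContinuousLinearMap.smulRightL ℝ E F (innerSL ℝ (b i)) (B x (b i)) from
    funext fun x => eq_sum_smulRight_basis b (B x)]
  exact integrable_finsetSum _ fun i _ => ContinuousLinearMap.integrable_comp _ (h i)

/-- Differentiability of an operator valued function can be checked on a basis. -/
theorem differentiableOn_of_basis {G : Type*} [NormedAddCommGroup G] [NormedSpace ℝ G]
    {B : G → E →L[ℝ] F} {s : Set G}
    (h : ∀ i, DifferentiableOn ℝ (fun x => B x (b i)) s) : DifferentiableOn ℝ B s := by
  rw [show B = fun x => ∑ i, ContinuousLinearMap.smulRightL ℝ E F (innerSL ℝ (b i)) (B x (b i)) from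
    funext fun x => eq_sum_smulRight_basis b (B x)]
  exact DifferentiableOn.fun_sum fun i _ =>
    (ContinuousLinearMap.differentiable _).comp_differentiableOn (h i)

end Basis

/-! ### Differentiation under the integral sign -/

section UnderIntegral

variable {𝓧 : Type*} [MeasurableSpace 𝓧] {p : ℕ} {ν : Measure 𝓧}
  {ω : Set (EuclideanSpace ℝ (Fin p))} {h : EuclideanSpace ℝ (Fin p) → 𝓧 → ℝ}

namespace DiffThriceUnderIntegral

/-- D3 concerns Bochner integrals of multilinear maps. Here and below, scalar statements come from
evaluation at fixed vectors, a continuous linear map that commutes with the integral. -/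
theorem integrable_fderiv (H : DiffThriceUnderIntegral ν ω h) {θ} (hθ : θ ∈ ω) (v) :
    Integrable (fun x => fderiv ℝ (fun η => h η x) θ v) ν := by
  have := (ContinuousMultilinearMap.apply ℝ (fun _ : Fin 1 => EuclideanSpace ℝ (Fin p)) ℝ
    ![v]).integrable_comp (H.integrable 1 (by norm_num) θ hθ)
  simpa [iteratedFDeriv_one_apply] using this

theorem integrable_fderiv_fderiv (H : DiffThriceUnderIntegral ν ω h) {θ} (hθ : θ ∈ ω) (v w) :
    Integrable (fun x => fderiv ℝ (fderiv ℝ fun η => h η x) θ v w) ν := by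
  have := (ContinuousMultilinearMap.apply ℝ (fun _ : Fin 2 => EuclideanSpace ℝ (Fin p)) ℝ
    ![v, w]).integrable_comp (H.integrable 2 (by norm_num) θ hθ)
  simpa [iteratedFDeriv_two_apply'] using this

theorem fderiv_integral (H : DiffThriceUnderIntegral ν ω h) {θ} (hθ : θ ∈ ω) (v) :
    fderiv ℝ (fun η => ∫ x, h η x ∂ν) θ v = ∫ x, fderiv ℝ (fun η => h η x) θ v ∂ν := by
  have h1 := (ContinuousMultilinearMap.apply ℝ (fun _ : Fin 1 => EuclideanSpace ℝ (Fin p)) ℝ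
    ![v]).integral_comp_comm (H.integrable 1 (by norm_num) θ hθ)
  rw [← H.deriv_eq 1 (by norm_num) θ hθ] at h1
  simpa [iteratedFDeriv_one_apply] using h1.symm

theorem fderiv_fderiv_integral (H : DiffThriceUnderIntegral ν ω h) {θ} (hθ : θ ∈ ω) (v w) :
    fderiv ℝ (fderiv ℝ fun η => ∫ x, h η x ∂ν) θ v w
      = ∫ x, fderiv ℝ (fderiv ℝ fun η => h η x) θ v w ∂ν := by
  have h1 := (ContinuousMultilinearMap.apply ℝ (fun _ : Fin 2 => EuclideanSpace ℝ (Fin p)) ℝ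
    ![v, w]).integral_comp_comm (H.integrable 2 (by norm_num) θ hθ)
  rw [← H.deriv_eq 2 (by norm_num) θ hθ] at h1
  simpa [iteratedFDeriv_two_apply'] using h1.symm

theorem differentiableOn (H : DiffThriceUnderIntegral ν ω h) :
    DifferentiableOn ℝ (fun η => ∫ x, h η x ∂ν) ω := by
  have h1 := (ContinuousMultilinearMap.apply ℝ (fun _ : Fin 0 => EuclideanSpace ℝ (Fin p)) ℝ
    ![]).differentiable.comp_differentiableOn (H.differentiable 0 (by norm_num))
  simpa [Function.comp_def] using h1

theorem differentiableOn_fderiv (H : DiffThriceUnderIntegral ν ω h) :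
    DifferentiableOn ℝ (fderiv ℝ fun η => ∫ x, h η x ∂ν) ω := by
  refine differentiableOn_of_basis (EuclideanSpace.basisFun (Fin p) ℝ) fun i => ?_
  have h1 := (ContinuousMultilinearMap.apply ℝ (fun _ : Fin 1 => EuclideanSpace ℝ (Fin p)) ℝ
    ![EuclideanSpace.basisFun (Fin p) ℝ i]).differentiable.comp_differentiableOn
      (H.differentiable 1 (by norm_num))
  simpa [Function.comp_def, iteratedFDeriv_one_apply] using h1

theorem differentiableOn_fderiv_fderiv (H : DiffThriceUnderIntegral ν ω h) :
    DifferentiableOn ℝ (fderiv ℝ (fderiv ℝ fun η => ∫ x, h η x ∂ν)) ω := by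
  refine differentiableOn_of_basis (EuclideanSpace.basisFun (Fin p) ℝ) fun i =>
    differentiableOn_of_basis (EuclideanSpace.basisFun (Fin p) ℝ) fun j => ?_
  have h1 := (ContinuousMultilinearMap.apply ℝ (fun _ : Fin 2 => EuclideanSpace ℝ (Fin p)) ℝ
    ![EuclideanSpace.basisFun (Fin p) ℝ i, EuclideanSpace.basisFun (Fin p) ℝ j]).differentiable
      |>.comp_differentiableOn (H.differentiable 2 (by norm_num))
  simpa [Function.comp_def, iteratedFDeriv_two_apply'] using h1

end DiffThriceUnderIntegral

end UnderIntegral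

/-! ### The score as the vector representing a derivative -/

section Riesz

variable {p : ℕ}

/-- The linear map sending a functional on Euclidean space to the vector representing it. -/
noncomputable def riesz (p : ℕ) :
    (EuclideanSpace ℝ (Fin p) →L[ℝ] ℝ) →L[ℝ] EuclideanSpace ℝ (Fin p) :=
  ∑ i, (ContinuousLinearMap.apply ℝ ℝ (EuclideanSpace.single i (1 : ℝ))).smulRight
    (EuclideanSpace.single i (1 : ℝ))

theorem riesz_apply (L : EuclideanSpace ℝ (Fin p) →L[ℝ] ℝ) (i : Fin p) :
    riesz p L i = L (EuclideanSpace.single i 1) := by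
  simp [riesz, sum_apply, Finset.sum_apply, Pi.single_apply]

theorem inner_riesz (L : EuclideanSpace ℝ (Fin p) →L[ℝ] ℝ) (v : EuclideanSpace ℝ (Fin p)) :
    inner ℝ (riesz p L) v = L v := by
  rw [apply_eq_sum_basis (EuclideanSpace.basisFun (Fin p) ℝ) L v, PiLp.inner_apply]
  simp [riesz_apply, EuclideanSpace.inner_single_left]

theorem score_eq_riesz {𝓧 : Type*} (f : EuclideanSpace ℝ (Fin p) → 𝓧 → ℝ)
    (θ : EuclideanSpace ℝ (Fin p)) (x : 𝓧) :
    score f θ x = riesz p (fderiv ℝ (fun η => Real.log (f η x)) θ) := by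
  refine ext_inner_right ℝ fun v => ?_
  rw [inner_riesz, score, gradient, InnerProductSpace.toDual_symm_apply]

end Riesz

variable {𝓧 : Type*} [MeasurableSpace 𝓧] {p : ℕ}

/-! ### The regular model and its estimating function -/

/-- The estimating function of the minimum density power divergence estimator. -/
noncomputable def dpdScore (μ : Measure 𝓧) (β : ℝ) (f : EuclideanSpace ℝ (Fin p) → 𝓧 → ℝ)
    (θ : EuclideanSpace ℝ (Fin p)) (x : 𝓧) : EuclideanSpace ℝ (Fin p) :=
  (f θ x ^ β) • score f θ x - ∫ y, (f θ y ^ (1 + β)) • score f θ y ∂μ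

/-- The regularity conditions in pointwise form: off the measurable set `G` of regular points, the
densities vanish almost everywhere. -/
structure RegularModel (μ : Measure 𝓧) (β : ℝ) (f : EuclideanSpace ℝ (Fin p) → 𝓧 → ℝ)
    (θ₀ : EuclideanSpace ℝ (Fin p)) (ω : Set (EuclideanSpace ℝ (Fin p))) (G : Set 𝓧)
    (M : Fin p → Fin p → Fin p → 𝓧 → ℝ) : Prop where
  exponent_nonneg : 0 ≤ β
  isOpen : IsOpen ω
  mem : θ₀ ∈ ω
  measurable : ∀ θ ∈ ω, Measurable (f θ)
  nonneg : ∀ θ ∈ ω, ∀ x, 0 ≤ f θ x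
  integral_eq_one : ∀ θ ∈ ω, ∫ x, f θ x ∂μ = 1
  measurableSet : MeasurableSet G
  pos : ∀ x ∈ G, ∀ θ ∈ ω, 0 < f θ x
  contDiffOn : ∀ x ∈ G, ContDiffOn ℝ 3 (fun θ => f θ x) ω
  bound : ∀ x ∈ G, ∀ θ ∈ ω, ∀ j k l,
    |fderiv ℝ (fderiv ℝ (fderiv ℝ fun η => objective μ β f η x)) θ (EuclideanSpace.single j 1)
      (EuclideanSpace.single k 1) (EuclideanSpace.single l 1)| ≤ M j k l x
  ae_mem : ∀ᵐ x ∂μ, x ∈ G ∨ ∀ θ ∈ ω, f θ x = 0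
  diff_model : DiffThriceUnderIntegral μ ω fun θ x => f θ x ^ (1 + β)
  diff_cross : DiffThriceUnderIntegral (law μ (f θ₀)) ω fun θ x => f θ x ^ β
  integrable_bound : ∀ j k l, Integrable (M j k l) (law μ (f θ₀))
  integrable_sq : ∀ θ ∈ ω, ∀ i,
    Integrable (fun x => score f θ x i ^ 2 * f θ x ^ (2 * β) * f θ x) μ

theorem exists_regularModel {μ : Measure 𝓧} {β : ℝ} (hβ : 0 ≤ β)
    {Θ : Set (EuclideanSpace ℝ (Fin p))} {f : EuclideanSpace ℝ (Fin p) → 𝓧 → ℝ}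
    (hf : IsDensityFamily μ Θ f) {θ₀ : EuclideanSpace ℝ (Fin p)}
    {ω : Set (EuclideanSpace ℝ (Fin p))} (hreg : RegularityConditions μ β Θ f (f θ₀) θ₀ ω)
    (hKint : ∀ θ ∈ ω, ∀ i,
      Integrable (fun x => score f θ x i ^ 2 * f θ x ^ (2 * β) * f θ x) μ) :
    ∃ G M, RegularModel μ β f θ₀ ω G M := by
  obtain ⟨M, hM, hMb⟩ := hreg.dominated
  obtain ⟨χ, hχ, -⟩ := hreg.common_support
  have hsub := hreg.subset
  have hm0 := hf.measurable θ₀ (hsub hreg.mem)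
  have hall : ∀ᵐ x ∂μ, 0 < f θ₀ x → ContDiffOn ℝ 3 (fun θ => f θ x) ω ∧ ∀ j k l, ∀ θ ∈ ω,
      |iteratedFDeriv ℝ 3 (fun η => objective μ β f η x) θ
        ![EuclideanSpace.single j 1, EuclideanSpace.single k 1, EuclideanSpace.single l 1]|
        ≤ M j k l x := by
    have h1 : ∀ j k l, ∀ᵐ x ∂μ, 0 < f θ₀ x → ∀ θ ∈ ω,
        |iteratedFDeriv ℝ 3 (fun η => objective μ β f η x) θ
          ![EuclideanSpace.single j 1, EuclideanSpace.single k 1, EuclideanSpace.single l 1]|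
          ≤ M j k l x := fun j k l => (ae_law hm0).1 (hMb j k l)
    simp only [← ae_all_iff] at h1
    filter_upwards [hreg.contDiffOn, h1] with x hx1 hx2 hx
    exact ⟨hx1 hx, fun j k l => hx2 j k l hx⟩
  -- The exceptional sets of D2 and D5 are absorbed in one measurable null set. Outside it, a point
  -- with $f_{\theta_0}=0$ lies off the common support, so every density with parameter in `ω`
  -- vanishes there.
  obtain ⟨N, hN, hNm, hN0⟩ := exists_measurable_superset_of_null (ae_iff.1 hall)
  have hmem : ∀ x, x ∈ Nᶜ ∩ {x | 0 < f θ₀ x} → 0 < f θ₀ x ∧ ContDiffOn ℝ 3 (fun θ => f θ x) ω ∧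
      ∀ j k l, ∀ θ ∈ ω, |iteratedFDeriv ℝ 3 (fun η => objective μ β f η x) θ
        ![EuclideanSpace.single j 1, EuclideanSpace.single k 1, EuclideanSpace.single l 1]|
        ≤ M j k l x := by
    rintro x ⟨hxN, hx⟩
    by_contra hc
    exact hxN (hN fun h => hc ⟨hx, h hx⟩)
  refine ⟨Nᶜ ∩ {x | 0 < f θ₀ x}, M, ?_⟩
  exact
  { exponent_nonneg := hβ
    isOpen := hreg.isOpen
    mem := hreg.mem
    measurable := fun θ hθ => hf.measurable θ (hsub hθ)
    nonneg := fun θ hθ => hf.nonneg θ (hsub hθ)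
    integral_eq_one := fun θ hθ => hf.integral_eq_one θ (hsub hθ)
    measurableSet := hNm.compl.inter (measurableSet_lt measurable_const hm0)
    pos := fun x hx θ hθ => (hχ θ (hsub hθ) x).2 ((hχ θ₀ (hsub hreg.mem) x).1 (hmem x hx).1)
    contDiffOn := fun x hx => (hmem x hx).2.1
    bound := fun x hx θ hθ j k l => by
      rw [← iteratedFDeriv_three_apply]
      exact (hmem x hx).2.2 j k l θ hθ
    ae_mem := by
      filter_upwards [measure_eq_zero_iff_ae_notMem.1 hN0] with x hx
      by_cases h0 : 0 < f θ₀ x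
      · exact Or.inl ⟨hx, h0⟩
      · refine Or.inr fun θ hθ => le_antisymm (not_lt.1 fun hlt => h0 ?_)
          (hf.nonneg θ (hsub hθ) x)
        exact (hχ θ₀ (hsub hreg.mem) x).2 ((hχ θ (hsub hθ) x).1 hlt)
    diff_model := hreg.diff_model
    diff_cross := hreg.diff_cross
    integrable_bound := hM
    integrable_sq := hKint }

namespace RegularModel

variable {μ : Measure 𝓧} {β : ℝ} {f : EuclideanSpace ℝ (Fin p) → 𝓧 → ℝ}
  {θ₀ θ : EuclideanSpace ℝ (Fin p)} {ω : Set (EuclideanSpace ℝ (Fin p))} {G : Set 𝓧}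
  {M : Fin p → Fin p → Fin p → 𝓧 → ℝ}

theorem isProbabilityMeasure (H : RegularModel μ β f θ₀ ω G M) (hθ : θ ∈ ω) :
    IsProbabilityMeasure (law μ (f θ)) :=
  isProbabilityMeasure_law (H.nonneg θ hθ) (H.integral_eq_one θ hθ)

theorem ae_mem_law (H : RegularModel μ β f θ₀ ω G M) (hθ : θ ∈ ω) :
    ∀ᵐ x ∂(law μ (f θ)), x ∈ G := by
  rw [ae_law (H.measurable θ hθ)]
  filter_upwards [H.ae_mem] with x hx h0
  exact hx.resolve_right fun h => h0.ne' (h θ hθ)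

/-- On `G` this is the chain rule. Elsewhere the densities vanish on the open set `ω`, so both sides
are zero because $1+\beta\ne0$. -/
theorem fderiv_model_ae (H : RegularModel μ β f θ₀ ω G M) (hθ : θ ∈ ω) :
    ∀ᵐ x ∂μ, fderiv ℝ (fun η => f η x ^ (1 + β)) θ
      = ((1 + β) * f θ x ^ (1 + β)) • fderiv ℝ (fun η => Real.log (f η x)) θ := by
  have hβ : 1 + β ≠ 0 := by linarith [H.exponent_nonneg]
  filter_upwards [H.ae_mem] with x hx
  rcases hx with hx | hx
  · exact fderiv_rpow_const_eq H.isOpen (H.contDiffOn x hx) (H.pos x hx) _ hθ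
  · have : (fun η => f η x ^ (1 + β)) =ᶠ[𝓝 θ] fun _ => (0 : ℝ) := by
      filter_upwards [H.isOpen.mem_nhds hθ] with η hη
      rw [hx η hη, Real.zero_rpow hβ]
    rw [this.fderiv_eq, hx θ hθ, Real.zero_rpow hβ]
    simp

theorem fderiv_fderiv_model_ae (H : RegularModel μ β f θ₀ ω G M) (hθ : θ ∈ ω)
    (v w : EuclideanSpace ℝ (Fin p)) :
    ∀ᵐ x ∂μ, fderiv ℝ (fderiv ℝ fun η => f η x ^ (1 + β)) θ v w
      = f θ x ^ (1 + β) * ((1 + β) * fderiv ℝ (fderiv ℝ fun η => Real.log (f η x)) θ v w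
        + (1 + β) ^ 2 * (fderiv ℝ (fun η => Real.log (f η x)) θ v
          * fderiv ℝ (fun η => Real.log (f η x)) θ w)) := by
  have hβ : 1 + β ≠ 0 := by linarith [H.exponent_nonneg]
  filter_upwards [H.ae_mem] with x hx
  rcases hx with hx | hx
  · exact fderiv_fderiv_rpow_const_apply H.isOpen (H.contDiffOn x hx) (H.pos x hx) _ hθ v w
  · have : (fun η => f η x ^ (1 + β)) =ᶠ[𝓝 θ] fun _ => (0 : ℝ) := by
      filter_upwards [H.isOpen.mem_nhds hθ] with η hη
      rw [hx η hη, Real.zero_rpow hβ]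
    rw [this.fderiv.fderiv_eq, hx θ hθ, Real.zero_rpow hβ]
    simp

theorem integrable_fderiv_model (H : RegularModel μ β f θ₀ ω G M) (hθ : θ ∈ ω) :
    Integrable (fun x => fderiv ℝ (fun η => f η x ^ (1 + β)) θ) μ :=
  integrable_of_basis (EuclideanSpace.basisFun (Fin p) ℝ) fun _ =>
    H.diff_model.integrable_fderiv hθ _

theorem smul_score_ae (H : RegularModel μ β f θ₀ ω G M) (hθ : θ ∈ ω) :
    (fun x => (f θ x ^ (1 + β)) • score f θ x) =ᵐ[μ]
      fun x => (1 + β)⁻¹ • riesz p (fderiv ℝ (fun η => f η x ^ (1 + β)) θ) := by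
  have hβ : 1 + β ≠ 0 := by linarith [H.exponent_nonneg]
  filter_upwards [H.fderiv_model_ae hθ] with x hx
  rw [hx, map_smul, smul_smul, score_eq_riesz, inv_mul_cancel_left₀ hβ]

theorem integrable_smul_score (H : RegularModel μ β f θ₀ ω G M) (hθ : θ ∈ ω) :
    Integrable (fun x => (f θ x ^ (1 + β)) • score f θ x) μ :=
  (((riesz p).integrable_comp (H.integrable_fderiv_model hθ)).smul (1 + β)⁻¹).congr
    (H.smul_score_ae hθ).symm

/-- The mean `ξ_β` is a multiple of the gradient of `∫ f_θ^{1+β}`. -/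
theorem integral_smul_score (H : RegularModel μ β f θ₀ ω G M) (hθ : θ ∈ ω) :
    ∫ x, (f θ x ^ (1 + β)) • score f θ x ∂μ
      = (1 + β)⁻¹ • riesz p (fderiv ℝ (fun η => ∫ x, f η x ^ (1 + β) ∂μ) θ) := by
  rw [integral_congr_ae (H.smul_score_ae hθ), integral_smul,
    (riesz p).integral_comp_comm (H.integrable_fderiv_model hθ)]
  congr 2
  ext v
  rw [H.diff_model.fderiv_integral hθ, ContinuousLinearMap.integral_apply
    (H.integrable_fderiv_model hθ)]

/-- One formula covers both definitions of the objective: for $\beta=0$ the integral is constantly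
one on `ω` and its derivative drops out. -/
theorem fderiv_objective (H : RegularModel μ β f θ₀ ω G M) {x : 𝓧} (hx : x ∈ G) (hθ : θ ∈ ω) :
    fderiv ℝ (fun η => objective μ β f η x) θ
      = fderiv ℝ (fun η => ∫ x, f η x ^ (1 + β) ∂μ) θ
        - ((1 + β) * f θ x ^ β) • fderiv ℝ (fun η => Real.log (f η x)) θ := by
  have hnhds := H.isOpen.mem_nhds hθ
  rcases H.exponent_nonneg.eq_or_lt' with hβ | hβ
  · subst hβ
    have h1 : (fun η => ∫ x, f η x ^ (1 + (0 : ℝ)) ∂μ) =ᶠ[𝓝 θ] fun _ => (1 : ℝ) := by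
      filter_upwards [hnhds] with η hη
      simpa using H.integral_eq_one η hη
    rw [h1.fderiv_eq]
    simp only [objective, if_true]
    rw [fderiv_fun_neg]
    simp
  · have h1 : DifferentiableAt ℝ (fun η => ∫ x, f η x ^ (1 + β) ∂μ) θ :=
      H.diff_model.differentiableOn.differentiableAt hnhds
    have h2 : DifferentiableAt ℝ (fun η => f η x ^ β) θ :=
      ((contDiffOn_rpow_const (H.contDiffOn x hx) (H.pos x hx) β).differentiableOn
        (by norm_num)).differentiableAt hnhds
    simp only [objective, hβ.ne', if_false]
    rw [fderiv_fun_sub h1 (h2.const_mul _), fderiv_const_mul h2,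
      fderiv_rpow_const_eq H.isOpen (H.contDiffOn x hx) (H.pos x hx) β hθ, smul_smul]
    congr 2
    field_simp
    ring

/-- Passing to the gradient of $V_\theta$ makes the hypotheses on $V_\theta$ available for the
estimating function. -/
theorem dpdScore_eq (H : RegularModel μ β f θ₀ ω G M) {x : 𝓧} (hx : x ∈ G) (hθ : θ ∈ ω) :
    dpdScore μ β f θ x = (-(1 + β)⁻¹ • riesz p) (fderiv ℝ (fun η => objective μ β f η x) θ) := by
  have hβ : 1 + β ≠ 0 := by linarith [H.exponent_nonneg]
  rw [dpdScore, H.integral_smul_score hθ, H.fderiv_objective hx hθ, score_eq_riesz, smul_apply,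
    map_sub, map_smul, smul_sub, smul_smul]
  rw [show -(1 + β)⁻¹ * ((1 + β) * f θ x ^ β) = -(f θ x ^ β) by field_simp]
  simp only [neg_smul]
  abel

theorem contDiffOn_smul_fderiv_log (H : RegularModel μ β f θ₀ ω G M) {x : 𝓧} (hx : x ∈ G) :
    ContDiffOn ℝ 2 (fun η => ((1 + β) * f η x ^ β) • fderiv ℝ (fun η => Real.log (f η x)) η) ω :=
  (contDiffOn_const.mul ((contDiffOn_rpow_const (H.contDiffOn x hx) (H.pos x hx) β).of_le
    (by norm_num))).smul (contDiffOn_fderiv (n := 2) H.isOpen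
      (contDiffOn_log (H.contDiffOn x hx) (H.pos x hx)))

theorem differentiableOn_fderiv_objective (H : RegularModel μ β f θ₀ ω G M) {x : 𝓧}
    (hx : x ∈ G) : DifferentiableOn ℝ (fderiv ℝ fun η => objective μ β f η x) ω :=
  (H.diff_model.differentiableOn_fderiv.sub
    ((H.contDiffOn_smul_fderiv_log hx).differentiableOn (by norm_num))).congr
    fun _ hθ => H.fderiv_objective hx hθ

theorem fderiv_fderiv_objective (H : RegularModel μ β f θ₀ ω G M) {x : 𝓧} (hx : x ∈ G)
    (hθ : θ ∈ ω) : fderiv ℝ (fderiv ℝ fun η => objective μ β f η x) θ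
      = fderiv ℝ (fderiv ℝ fun η => ∫ x, f η x ^ (1 + β) ∂μ) θ
        - fderiv ℝ (fun η => ((1 + β) * f η x ^ β) •
            fderiv ℝ (fun η => Real.log (f η x)) η) θ := by
  have hnhds := H.isOpen.mem_nhds hθ
  have heq : (fderiv ℝ fun η => objective μ β f η x) =ᶠ[𝓝 θ]
      fun η => fderiv ℝ (fun η => ∫ x, f η x ^ (1 + β) ∂μ) η
        - ((1 + β) * f η x ^ β) • fderiv ℝ (fun η => Real.log (f η x)) η := by
    filter_upwards [hnhds] with η hη
    exact H.fderiv_objective hx hη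
  rw [heq.fderiv_eq, fderiv_fun_sub (H.diff_model.differentiableOn_fderiv.differentiableAt hnhds)
    (((H.contDiffOn_smul_fderiv_log hx).differentiableOn (by norm_num)).differentiableAt hnhds)]

/-- This is what lets the third derivative bound act as a Lipschitz constant for the Hessian; D3
handles the integral and D2 the pointwise part. -/
theorem differentiableOn_fderiv_fderiv_objective (H : RegularModel μ β f θ₀ ω G M) {x : 𝓧}
    (hx : x ∈ G) :
    DifferentiableOn ℝ (fderiv ℝ (fderiv ℝ fun η => objective μ β f η x)) ω :=
  (H.diff_model.differentiableOn_fderiv_fderiv.sub ((contDiffOn_fderiv (n := 1) H.isOpen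
    (H.contDiffOn_smul_fderiv_log hx)).differentiableOn (by norm_num))).congr
    fun _ hθ => H.fderiv_fderiv_objective hx hθ

theorem fderiv_fderiv_objective_apply (H : RegularModel μ β f θ₀ ω G M) {x : 𝓧} (hx : x ∈ G)
    (hθ : θ ∈ ω) (v w : EuclideanSpace ℝ (Fin p)) :
    fderiv ℝ (fderiv ℝ fun η => objective μ β f η x) θ v w
      = fderiv ℝ (fderiv ℝ fun η => ∫ x, f η x ^ (1 + β) ∂μ) θ v w
        - (1 + β) * (f θ x ^ β * (fderiv ℝ (fderiv ℝ fun η => Real.log (f η x)) θ v w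
          + β * (fderiv ℝ (fun η => Real.log (f η x)) θ v
            * fderiv ℝ (fun η => Real.log (f η x)) θ w))) := by
  have hnhds := H.isOpen.mem_nhds hθ
  have h1 : DifferentiableAt ℝ (fun η => f η x ^ β) θ :=
    ((contDiffOn_rpow_const (H.contDiffOn x hx) (H.pos x hx) β).differentiableOn
      (by norm_num)).differentiableAt hnhds
  have h2 : DifferentiableAt ℝ (fderiv ℝ fun η => Real.log (f η x)) θ :=
    ((contDiffOn_fderiv (n := 2) H.isOpen (contDiffOn_log (H.contDiffOn x hx)
      (H.pos x hx))).differentiableOn (by norm_num)).differentiableAt hnhds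
  have h3 : HasFDerivAt (fun η => ((1 + β) * f η x ^ β) •
      fderiv ℝ (fun η => Real.log (f η x)) η) _ θ :=
    (h1.hasFDerivAt.const_mul (1 + β)).smul h2.hasFDerivAt
  rw [H.fderiv_fderiv_objective hx hθ, h3.fderiv,
    fderiv_rpow_const_eq H.isOpen (H.contDiffOn x hx) (H.pos x hx) β hθ]
  simp
  ring

end RegularModel

theorem eq_sum_single {p : ℕ} (v : EuclideanSpace ℝ (Fin p)) :
    v = ∑ i, v i • EuclideanSpace.single i (1 : ℝ) := by
  ext i
  simp [Finset.sum_apply, Pi.single_apply]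

theorem fderiv_log_single {𝓧 : Type*} {p : ℕ} (f : EuclideanSpace ℝ (Fin p) → 𝓧 → ℝ)
    (θ : EuclideanSpace ℝ (Fin p)) (x : 𝓧) (i : Fin p) :
    fderiv ℝ (fun η => Real.log (f η x)) θ (EuclideanSpace.single i 1) = score f θ x i := by
  rw [score_eq_riesz, riesz_apply]

variable {𝓧 : Type*} [MeasurableSpace 𝓧] {p : ℕ}

/-! ### Measurability, moments and regularity of the estimating function -/

namespace RegularModel

variable {μ : Measure 𝓧} {β : ℝ} {f : EuclideanSpace ℝ (Fin p) → 𝓧 → ℝ}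
  {θ₀ θ : EuclideanSpace ℝ (Fin p)} {ω : Set (EuclideanSpace ℝ (Fin p))} {G : Set 𝓧}
  {M : Fin p → Fin p → Fin p → 𝓧 → ℝ}

theorem measurable_indicator_fderiv_log (H : RegularModel μ β f θ₀ ω G M) (hθ : θ ∈ ω)
    (v : EuclideanSpace ℝ (Fin p)) :
    Measurable (G.indicator fun x => fderiv ℝ (fun η => Real.log (f η x)) θ v) := by
  have hlim : Tendsto (fun n : ℕ => θ + ((n : ℝ))⁻¹ • v) atTop (𝓝 θ) := by
    have : Tendsto (fun n : ℕ => (n : ℝ)⁻¹) atTop (𝓝 0) := tendsto_inv_atTop_nhds_zero_nat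
    simpa using (this.smul_const v).const_add θ
  -- The derivative is a limit of difference quotients. Shifting the index by `N` keeps all
  -- evaluation points in `ω`, where the densities are measurable.
  obtain ⟨N, hN⟩ := eventually_atTop.1 (hlim.eventually (H.isOpen.mem_nhds hθ))
  refine measurable_of_tendsto_metrizable (f := fun (n : ℕ) => G.indicator fun x =>
    ((n + N : ℕ) : ℝ) • (Real.log (f (θ + ((n + N : ℕ) : ℝ)⁻¹ • v) x) - Real.log (f θ x)))
    (fun n => ?_) ?_
  · exact (((H.measurable _ (hN (n + N) (by omega))).log.sub (H.measurable θ hθ).log).const_smul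
      ((n + N : ℕ) : ℝ)).indicator H.measurableSet
  · rw [tendsto_pi_nhds]
    intro x
    by_cases hx : x ∈ G
    · simp only [Set.indicator_of_mem hx]
      have hd : DifferentiableAt ℝ (fun η => Real.log (f η x)) θ :=
        ((contDiffOn_log (H.contDiffOn x hx) (H.pos x hx)).differentiableOn
          (by norm_num)).differentiableAt (H.isOpen.mem_nhds hθ)
      refine hd.hasFDerivAt.lim v (c := fun n : ℕ => ((n + N : ℕ) : ℝ)) ?_
      simp only [Real.norm_natCast]
      exact tendsto_natCast_atTop_atTop.comp (tendsto_add_atTop_nat N)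
    · simp only [Set.indicator_of_notMem hx]
      exact tendsto_const_nhds

theorem measurable_indicator_score (H : RegularModel μ β f θ₀ ω G M) (hθ : θ ∈ ω) :
    Measurable (G.indicator (score f θ)) := by
  have h1 : G.indicator (score f θ) = fun x => ∑ i, (G.indicator (fun x =>
      fderiv ℝ (fun η => Real.log (f η x)) θ (EuclideanSpace.single i 1)) x) •
        EuclideanSpace.single i (1 : ℝ) := by
    funext x
    by_cases hx : x ∈ G
    · simp only [Set.indicator_of_mem hx]
      rw [eq_sum_single (score f θ x)]
      simp only [score_eq_riesz, riesz_apply]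
    · simp [hx]
  rw [h1]
  exact Finset.measurable_fun_sum _ fun i _ =>
    (H.measurable_indicator_fderiv_log hθ _).smul_const _

theorem measurable_indicator_dpdScore (H : RegularModel μ β f θ₀ ω G M) (hθ : θ ∈ ω) :
    Measurable (G.indicator (dpdScore μ β f θ)) := by
  have h1 : G.indicator (dpdScore μ β f θ) = G.indicator fun x =>
      (f θ x ^ β) • G.indicator (score f θ) x - ∫ y, (f θ y ^ (1 + β)) • score f θ y ∂μ := by
    funext x
    by_cases hx : x ∈ G <;> simp [hx, dpdScore]
  rw [h1]
  exact ((((H.measurable θ hθ).pow_const β).smul (H.measurable_indicator_score hθ)).sub_const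
    _).indicator H.measurableSet

/-- The second moment is the integral assumed finite for $K_\beta$; measurability comes from the
version of the score cut off outside `G`. -/
theorem memLp_score (H : RegularModel μ β f θ₀ ω G M) (hθ : θ ∈ ω) (i : Fin p) :
    MemLp (fun x => f θ x ^ β * score f θ x i) 2 (law μ (f θ)) := by
  have hm : AEStronglyMeasurable (fun x => f θ x ^ β * score f θ x i) (law μ (f θ)) := by
    have h1 : Measurable fun x => f θ x ^ β * G.indicator (score f θ) x i :=
      ((H.measurable θ hθ).pow_const β).mul
        ((by fun_prop : Measurable fun v : EuclideanSpace ℝ (Fin p) => v i).comp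
          (H.measurable_indicator_score hθ))
    refine h1.aestronglyMeasurable.congr ?_
    filter_upwards [H.ae_mem_law hθ] with x hx
    simp [hx]
  rw [memLp_two_iff_integrable_sq hm, integrable_law (H.measurable θ hθ) (H.nonneg θ hθ)]
  refine (H.integrable_sq θ hθ i).congr (Eventually.of_forall fun x => ?_)
  have h2 : f θ x ^ (2 * β) = (f θ x ^ β) ^ 2 := by
    rw [mul_comm, Real.rpow_mul (H.nonneg θ hθ x), Real.rpow_two]
  simp only [h2, smul_eq_mul]
  ring

theorem rpow_one_add (H : RegularModel μ β f θ₀ ω G M) (hθ : θ ∈ ω) (x : 𝓧) :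
    f θ x ^ (1 + β) = f θ x * f θ x ^ β := by
  have hβ := H.exponent_nonneg
  rcases (H.nonneg θ hθ x).eq_or_lt' with h | h
  · rw [h, zero_mul, Real.zero_rpow (by linarith)]
  · rw [Real.rpow_add h, Real.rpow_one]

/-- Products of log-derivatives are integrable with weight `f_θ₀^{1+2β}`. -/
theorem integrable_law_score_mul (H : RegularModel μ β f θ₀ ω G M) (hθ : θ ∈ ω) (i j : Fin p) :
    Integrable (fun x => (f θ x ^ β * score f θ x i) * (f θ x ^ β * score f θ x j))
      (law μ (f θ)) :=
  (H.memLp_score hθ i).integrable_mul (H.memLp_score hθ j)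

theorem integrable_cross (H : RegularModel μ β f θ₀ ω G M) (i j : Fin p) :
    Integrable (fun x => f θ₀ x ^ β * (fderiv ℝ (fderiv ℝ fun η => Real.log (f η x)) θ₀
      (EuclideanSpace.single i 1) (EuclideanSpace.single j 1)
        + β * (score f θ₀ x i * score f θ₀ x j))) (law μ (f θ₀)) := by
  have hm := H.measurable θ₀ H.mem
  have h0 := H.nonneg θ₀ H.mem
  -- For $\beta=0$ the cross integrand $f_\theta^\beta$ carries no information; the second
  -- derivative of $f_\theta$ minus the integrable product of scores is used instead. For $\beta>0$
  -- the integrand is $\beta^{-1}D^2f_\theta^\beta$.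
  rcases H.exponent_nonneg.eq_or_lt' with hβ | hβ
  · have h1 := H.integrable_law_score_mul H.mem i j
    rw [integrable_law hm h0] at h1 ⊢
    refine ((H.diff_model.integrable_fderiv_fderiv H.mem (EuclideanSpace.single i 1)
      (EuclideanSpace.single j 1)).sub h1).congr ?_
    filter_upwards [H.fderiv_fderiv_model_ae H.mem (EuclideanSpace.single i 1)
      (EuclideanSpace.single j 1)] with x hx
    simp only [Pi.sub_apply]
    rw [hx]
    simp only [fderiv_log_single, hβ]
    simp
    ring
  · refine ((H.diff_cross.integrable_fderiv_fderiv H.mem (EuclideanSpace.single i 1)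
      (EuclideanSpace.single j 1)).const_mul β⁻¹).congr ?_
    filter_upwards [H.ae_mem_law H.mem] with x hx
    rw [fderiv_fderiv_rpow_const_apply H.isOpen (H.contDiffOn x hx) (H.pos x hx) β H.mem]
    simp only [fderiv_log_single]
    field_simp

theorem integrable_fderiv_fderiv_objective (H : RegularModel μ β f θ₀ ω G M) (i j : Fin p) :
    Integrable (fun x => fderiv ℝ (fderiv ℝ fun η => objective μ β f η x) θ₀
      (EuclideanSpace.single i 1) (EuclideanSpace.single j 1)) (law μ (f θ₀)) := by
  have := H.isProbabilityMeasure H.mem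
  refine ((integrable_const (fderiv ℝ (fderiv ℝ fun η => ∫ x, f η x ^ (1 + β) ∂μ) θ₀
    (EuclideanSpace.single i 1) (EuclideanSpace.single j 1))).sub
      ((H.integrable_cross i j).const_mul (1 + β))).congr ?_
  filter_upwards [H.ae_mem_law H.mem] with x hx
  simp only [Pi.sub_apply]
  rw [H.fderiv_fderiv_objective_apply hx H.mem]
  simp only [fderiv_log_single]

/-- The mean of the Hessian of the objective is `(1 + β) J_β`. -/
theorem integral_fderiv_fderiv_objective (H : RegularModel μ β f θ₀ ω G M) (i j : Fin p) :
    ∫ x, fderiv ℝ (fderiv ℝ fun η => objective μ β f η x) θ₀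
      (EuclideanSpace.single i 1) (EuclideanSpace.single j 1) ∂(law μ (f θ₀))
      = (1 + β) * Jmat μ β f (f θ₀) θ₀ i j := by
  have := H.isProbabilityMeasure H.mem
  have hm := H.measurable θ₀ H.mem
  have h0 := H.nonneg θ₀ H.mem
  have hc := H.integrable_cross i j
  have h1 : ∫ x, fderiv ℝ (fderiv ℝ fun η => objective μ β f η x) θ₀
      (EuclideanSpace.single i 1) (EuclideanSpace.single j 1) ∂(law μ (f θ₀))
      = fderiv ℝ (fderiv ℝ fun η => ∫ x, f η x ^ (1 + β) ∂μ) θ₀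
        (EuclideanSpace.single i 1) (EuclideanSpace.single j 1)
        - (1 + β) * ∫ x, f θ₀ x ^ β * (fderiv ℝ (fderiv ℝ fun η => Real.log (f η x)) θ₀
      (EuclideanSpace.single i 1) (EuclideanSpace.single j 1)
        + β * (score f θ₀ x i * score f θ₀ x j)) ∂(law μ (f θ₀)) := by
    rw [← integral_const_mul, integral_congr_ae (g := fun x =>
      fderiv ℝ (fderiv ℝ fun η => ∫ x, f η x ^ (1 + β) ∂μ) θ₀
        (EuclideanSpace.single i 1) (EuclideanSpace.single j 1)
        - (1 + β) * (f θ₀ x ^ β * (fderiv ℝ (fderiv ℝ fun η => Real.log (f η x)) θ₀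
      (EuclideanSpace.single i 1) (EuclideanSpace.single j 1)
        + β * (score f θ₀ x i * score f θ₀ x j))))]
    · rw [integral_sub (integrable_const _) (hc.const_mul _)]
      simp
    · filter_upwards [H.ae_mem_law H.mem] with x hx
      rw [H.fderiv_fderiv_objective_apply hx H.mem]
      simp only [fderiv_log_single]
  -- Under one integral the Hessians of $\log f$ cancel, and the coefficient of $uu^T$ is
  -- $(1+\beta)^2-\beta(1+\beta)=1+\beta$.
  rw [h1, H.diff_model.fderiv_fderiv_integral H.mem, integral_law hm h0, ← integral_const_mul,
    ← integral_sub (H.diff_model.integrable_fderiv_fderiv H.mem _ _)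
      (((integrable_law hm h0).1 hc).const_mul _)]
  -- At the model the second integral in `Jmat` contains the factor $g-f_{\theta_0}=0$.
  have h2 : Jmat μ β f (f θ₀) θ₀ i j
      = ∫ x, score f θ₀ x i * score f θ₀ x j * f θ₀ x ^ (1 + β) ∂μ := by
    simp [Jmat]
  rw [h2, ← integral_const_mul]
  refine integral_congr_ae ?_
  filter_upwards [H.fderiv_fderiv_model_ae H.mem (EuclideanSpace.single i 1)
      (EuclideanSpace.single j 1)] with x hx
  rw [hx]
  simp only [fderiv_log_single, H.rpow_one_add H.mem, smul_eq_mul]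
  ring

/-- The subtracted integral is the mean of $f_\theta^\beta u_\theta$ under $f_\theta$, because
$f_\theta\cdot f_\theta^\beta=f_\theta^{1+\beta}$. -/
theorem integrable_dpdScore (H : RegularModel μ β f θ₀ ω G M) (hθ : θ ∈ ω) :
    Integrable (dpdScore μ β f θ) (law μ (f θ)) ∧ ∫ x, dpdScore μ β f θ x ∂(law μ (f θ)) = 0 := by
  have := H.isProbabilityMeasure hθ
  have hm := H.measurable θ hθ
  have h0 := H.nonneg θ hθ
  have hi : Integrable (fun x => (f θ x ^ β) • score f θ x) (law μ (f θ)) := by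
    rw [integrable_law hm h0]
    refine (H.integrable_smul_score hθ).congr (Eventually.of_forall fun x => ?_)
    simp only [H.rpow_one_add hθ, smul_smul]
  refine ⟨hi.sub (integrable_const _), ?_⟩
  simp only [dpdScore]
  rw [integral_sub hi (integrable_const _), integral_law hm h0]
  simp only [H.rpow_one_add hθ, smul_smul, integral_const, probReal_univ, one_smul, sub_self]

theorem integral_score (H : RegularModel μ β f θ₀ ω G M) (hθ : θ ∈ ω) (i : Fin p) :
    (∫ y, (f θ y ^ (1 + β)) • score f θ y ∂μ) i = xiVec μ β f (f θ) θ i ∧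
    ∫ x, f θ x ^ β * score f θ x i ∂(law μ (f θ)) = xiVec μ β f (f θ) θ i := by
  constructor
  · have h1 : ∫ x, ((f θ x ^ (1 + β)) • score f θ x) i ∂μ
        = (∫ y, (f θ y ^ (1 + β)) • score f θ y ∂μ) i :=
      (EuclideanSpace.proj i : EuclideanSpace ℝ (Fin p) →L[ℝ] ℝ).integral_comp_comm
        (H.integrable_smul_score hθ)
    rw [← h1, xiVec]
    refine integral_congr_ae (Eventually.of_forall fun x => ?_)
    simp only [H.rpow_one_add hθ, PiLp.smul_apply, smul_eq_mul]
    ring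
  · rw [integral_law (H.measurable θ hθ) (H.nonneg θ hθ), xiVec]
    refine integral_congr_ae (Eventually.of_forall fun x => ?_)
    simp only [smul_eq_mul]
    ring

theorem dpdScore_apply (H : RegularModel μ β f θ₀ ω G M) (hθ : θ ∈ ω) (x : 𝓧) (i : Fin p) :
    dpdScore μ β f θ x i = f θ x ^ β * score f θ x i - xiVec μ β f (f θ) θ i := by
  rw [← (H.integral_score hθ i).1]
  rfl

theorem memLp_inner_dpdScore (H : RegularModel μ β f θ₀ ω G M) (hθ : θ ∈ ω)
    (s : EuclideanSpace ℝ (Fin p)) :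
    MemLp (fun x => inner ℝ (dpdScore μ β f θ x) s) 2 (law μ (f θ)) := by
  have := H.isProbabilityMeasure hθ
  have h1 : (fun x => inner ℝ (dpdScore μ β f θ x) s) = fun x =>
      ∑ i, s i * (f θ x ^ β * score f θ x i - xiVec μ β f (f θ) θ i) := by
    funext x
    rw [PiLp.inner_apply]
    simp [H.dpdScore_apply hθ]
  rw [h1]
  exact memLp_finsetSum _ fun i _ => ((H.memLp_score hθ i).sub (memLp_const _)).const_mul _

/-- `K_β` is the covariance matrix of the estimating function. -/
theorem integral_inner_dpdScore_sq (H : RegularModel μ β f θ₀ ω G M) (hθ : θ ∈ ω)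
    (s : EuclideanSpace ℝ (Fin p)) :
    ∫ x, inner ℝ (dpdScore μ β f θ x) s ^ 2 ∂(law μ (f θ))
      = s.ofLp ⬝ᵥ (Kmat μ β f (f θ) θ *ᵥ s.ofLp) := by
  have := H.isProbabilityMeasure hθ
  set w : Fin p → 𝓧 → ℝ := fun i x => f θ x ^ β * score f θ x i with hw
  set m : Fin p → ℝ := xiVec μ β f (f θ) θ with hmdef
  have hwi : ∀ i, Integrable (w i) (law μ (f θ)) := fun i =>
    (H.memLp_score hθ i).integrable (by norm_num)
  have hm : ∀ i, ∫ x, w i x ∂(law μ (f θ)) = m i := fun i => (H.integral_score hθ i).2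
  have hww : ∀ i j, Integrable (fun x => w i x * w j x) (law μ (f θ)) := fun i j =>
    H.integrable_law_score_mul hθ i j
  have hK : ∀ i j, ∫ x, w i x * w j x ∂(law μ (f θ)) - m i * m j = Kmat μ β f (f θ) θ i j := by
    intro i j
    simp only [Kmat, Matrix.of_apply]
    rw [integral_law (H.measurable θ hθ) (H.nonneg θ hθ)]
    congr 1
    refine integral_congr_ae (Eventually.of_forall fun x => ?_)
    have h2 : f θ x ^ (2 * β) = (f θ x ^ β) ^ 2 := by
      rw [mul_comm, Real.rpow_mul (H.nonneg θ hθ x), Real.rpow_two]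
    simp only [h2, hw, smul_eq_mul]
    ring
  have hcov : ∀ i j, Integrable (fun x => (w i x - m i) * (w j x - m j)) (law μ (f θ)) ∧
      ∫ x, (w i x - m i) * (w j x - m j) ∂(law μ (f θ)) = Kmat μ β f (f θ) θ i j := by
    intro i j
    have e : (fun x => (w i x - m i) * (w j x - m j))
        = fun x => w i x * w j x - m j * w i x - (m i * w j x - m i * m j) := by
      funext x; ring
    have i1 : Integrable (fun x => w i x * w j x - m j * w i x) (law μ (f θ)) :=
      (hww i j).sub ((hwi i).const_mul _)
    have i2 : Integrable (fun x => m i * w j x - m i * m j) (law μ (f θ)) :=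
      ((hwi j).const_mul _).sub (integrable_const _)
    rw [e]
    refine ⟨i1.sub i2, ?_⟩
    rw [integral_sub i1 i2, integral_sub (hww i j) ((hwi i).const_mul _),
      integral_sub ((hwi j).const_mul _) (integrable_const _), integral_const_mul,
      integral_const_mul, hm, hm, ← hK]
    simp
    ring
  have hexp : ∀ x, inner ℝ (dpdScore μ β f θ x) s ^ 2
      = ∑ i, ∑ j, s i * s j * ((w i x - m i) * (w j x - m j)) := by
    intro x
    rw [PiLp.inner_apply, sq, Finset.sum_mul_sum]
    refine Finset.sum_congr rfl fun i _ => Finset.sum_congr rfl fun j _ => ?_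
    simp only [RCLike.inner_apply, conj_trivial, H.dpdScore_apply hθ, hw, hmdef]
    ring
  simp_rw [hexp]
  rw [integral_finsetSum _ fun i _ => integrable_finsetSum _ fun j _ =>
    ((hcov i j).1.const_mul _)]
  simp only [dotProduct, Matrix.mulVec, Finset.mul_sum]
  refine Finset.sum_congr rfl fun i _ => ?_
  rw [integral_finsetSum _ fun j _ => ((hcov i j).1.const_mul _)]
  refine Finset.sum_congr rfl fun j _ => ?_
  rw [integral_const_mul, (hcov i j).2]
  ring

theorem continuousAt_dpdScore (H : RegularModel μ β f θ₀ ω G M) {x : 𝓧} (hx : x ∈ G)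
    (hθ : θ ∈ ω) : ContinuousAt (fun θ => dpdScore μ β f θ x) θ := by
  have hnhds := H.isOpen.mem_nhds hθ
  have h1 := (((H.differentiableOn_fderiv_objective hx).differentiableAt hnhds).continuousAt)
  refine ((-(1 + β)⁻¹ • riesz p).continuous.continuousAt.comp h1).congr ?_
  filter_upwards [hnhds] with η hη
  exact (H.dpdScore_eq hx hη).symm

theorem continuousAt_density (H : RegularModel μ β f θ₀ ω G M) {x : 𝓧} (hx : x ∈ G)
    (hθ : θ ∈ ω) : ContinuousAt (fun θ => f θ x) θ :=
  (H.contDiffOn x hx).continuousOn.continuousAt (H.isOpen.mem_nhds hθ)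

/-- The estimating function satisfies the hypotheses of the general theory of estimating
equations. -/
theorem regularEstimatingFunction (H : RegularModel μ β f θ₀ ω G M) {r : ℝ} (hr : 0 < r)
    (hrω : Metric.closedBall θ₀ r ⊆ ω) :
    RegularEstimatingFunction (law μ (f θ₀)) G θ₀ r (dpdScore μ β f)
      (fun x => (-(1 + β)⁻¹ • riesz p) ∘L
        fderiv ℝ (fderiv ℝ fun η => objective μ β f η x) θ₀)
      (fun x => ‖-(1 + β)⁻¹ • riesz p‖ * ∑ j, ∑ k, ∑ l, M j k l x)
      (Matrix.toEuclideanCLM (𝕜 := ℝ) (Jmat μ β f (f θ₀) θ₀)) where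
  pos := hr
  ae_mem := H.ae_mem_law H.mem
  linearize := by
    intro x hx ρ hρ a ha b hb
    have hsub : Metric.closedBall θ₀ ρ ⊆ ω :=
      (Metric.closedBall_subset_closedBall hρ).trans hrω
    have hρ0 : 0 ≤ ρ := dist_nonneg.trans ha
    set R := -(1 + β)⁻¹ • riesz p with hR
    set D := fderiv ℝ fun η => objective μ β f η x with hD
    have hD1 := H.differentiableOn_fderiv_objective hx
    have hD2 := H.differentiableOn_fderiv_fderiv_objective hx
    have hS : 0 ≤ ∑ j, ∑ k, ∑ l, M j k l x :=
      Finset.sum_nonneg fun j _ => Finset.sum_nonneg fun k _ => Finset.sum_nonneg fun l _ =>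
        (abs_nonneg _).trans (H.bound x hx θ₀ H.mem j k l)
    -- Two mean value inequalities on the convex ball: the third derivative bound controls the
    -- oscillation of the Hessian, which then controls the deviation of the gradient from its
    -- linearization at `θ₀`.
    have hlip : ∀ θ ∈ Metric.closedBall θ₀ ρ,
        ‖fderiv ℝ D θ - fderiv ℝ D θ₀‖ ≤ (∑ j, ∑ k, ∑ l, M j k l x) * ρ := by
      intro θ hθ
      refine ((convex_closedBall θ₀ ρ).norm_image_sub_le_of_norm_hasFDerivWithin_le
        (f := fderiv ℝ D) (f' := fderiv ℝ (fderiv ℝ D)) (C := ∑ j, ∑ k, ∑ l, M j k l x)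
        (fun η hη => ?_) (fun η hη => ?_) (Metric.mem_closedBall_self hρ0) hθ).trans ?_
      · exact (hD2.differentiableAt (H.isOpen.mem_nhds (hsub hη))).hasFDerivAt.hasFDerivWithinAt
      · refine norm_le_sum_of_basis_bound (EuclideanSpace.basisFun (Fin p) ℝ) _ fun j k l => ?_
        simpa using H.bound x hx η (hsub hη) j k l
      · exact mul_le_mul_of_nonneg_left (mem_closedBall_iff_norm.1 hθ) hS
    have hmv := (convex_closedBall θ₀ ρ).norm_image_sub_le_of_norm_hasFDerivWithin_le'
      (f := D) (f' := fderiv ℝ D) (φ := fderiv ℝ D θ₀) (C := (∑ j, ∑ k, ∑ l, M j k l x) * ρ)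
      (fun η hη => (hD1.differentiableAt
        (H.isOpen.mem_nhds (hsub hη))).hasFDerivAt.hasFDerivWithinAt) hlip hb ha
    rw [H.dpdScore_eq hx (hsub ha), H.dpdScore_eq hx (hsub hb), ContinuousLinearMap.comp_apply,
      ← map_sub, ← map_sub]
    refine (R.le_opNorm _).trans ((mul_le_mul_of_nonneg_left hmv (norm_nonneg R)).trans_eq ?_)
    ring
  integrable_deriv :=
    (ContinuousLinearMap.compL ℝ (EuclideanSpace ℝ (Fin p)) (EuclideanSpace ℝ (Fin p) →L[ℝ] ℝ)
      (EuclideanSpace ℝ (Fin p)) (-(1 + β)⁻¹ • riesz p)).integrable_comp <|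
      integrable_of_basis (EuclideanSpace.basisFun (Fin p) ℝ) fun i =>
        integrable_of_basis (EuclideanSpace.basisFun (Fin p) ℝ) fun j => by
          simpa using H.integrable_fderiv_fderiv_objective i j
  integral_deriv := by
    have hi1 : ∀ i, Integrable (fun x => fderiv ℝ (fderiv ℝ fun η => objective μ β f η x) θ₀
        (EuclideanSpace.single i 1)) (law μ (f θ₀)) := fun i =>
      integrable_of_basis (EuclideanSpace.basisFun (Fin p) ℝ) fun j => by
          simpa using H.integrable_fderiv_fderiv_objective i j
    have hi2 : Integrable (fun x => fderiv ℝ (fderiv ℝ fun η => objective μ β f η x) θ₀)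
        (law μ (f θ₀)) := integrable_of_basis (EuclideanSpace.basisFun (Fin p) ℝ) fun i => by
          simpa using hi1 i
    have hβ : 1 + β ≠ 0 := by linarith [H.exponent_nonneg]
    have e1 := (ContinuousLinearMap.compL ℝ (EuclideanSpace ℝ (Fin p))
      (EuclideanSpace ℝ (Fin p) →L[ℝ] ℝ) (EuclideanSpace ℝ (Fin p))
      (-(1 + β)⁻¹ • riesz p)).integral_comp_comm hi2
    simp only [ContinuousLinearMap.compL_apply] at e1
    rw [e1]
    have e2 : ∀ i j, (∫ x, fderiv ℝ (fderiv ℝ fun η => objective μ β f η x) θ₀ ∂(law μ (f θ₀)))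
        (EuclideanSpace.single j 1) (EuclideanSpace.single i 1)
        = (1 + β) * Jmat μ β f (f θ₀) θ₀ i j := by
      intro i j
      rw [ContinuousLinearMap.integral_apply hi2, ContinuousLinearMap.integral_apply (hi1 j),
        H.integral_fderiv_fderiv_objective j i]
      -- The indices arrive transposed; at the model $J_\beta$ is visibly symmetric.
      simp only [Jmat, Matrix.of_apply, sub_self, mul_zero, zero_mul, integral_zero, add_zero]
      congr 2
      funext x
      ring
    refine ContinuousLinearMap.ext fun v => ?_
    rw [eq_sum_single v]
    simp only [map_sum, map_smul]
    refine Finset.sum_congr rfl fun j _ => ?_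
    congr 1
    ext i
    rw [ContinuousLinearMap.comp_apply, smul_apply, PiLp.smul_apply, riesz_apply, e2]
    simp [hβ, Matrix.mulVec_single]
  integrable_bound := (integrable_finsetSum _ fun j _ => integrable_finsetSum _ fun k _ =>
    integrable_finsetSum _ fun l _ => H.integrable_bound j k l).const_mul _
  integrable := (H.integrable_dpdScore H.mem).1
  integral_eq_zero := (H.integrable_dpdScore H.mem).2

end RegularModel

/-! ### Factors of the inverse covariance -/

section LinearAlgebra

variable {p : ℕ}

/-- A positive definite matrix has a square root factor mapping a given vector to any given vector
of the right length. -/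
theorem exists_factor_map_eq {S : Matrix (Fin p) (Fin p) ℝ} (hS : S.PosSemidef)
    (d w : EuclideanSpace ℝ (Fin p)) (hw : ‖w‖ ^ 2 = d.ofLp ⬝ᵥ (S *ᵥ d.ofLp)) :
    ∃ C : Matrix (Fin p) (Fin p) ℝ, Cᵀ * C = S ∧ Matrix.toEuclideanCLM (𝕜 := ℝ) C d = w := by
  obtain ⟨B, hB⟩ : ∃ B : Matrix (Fin p) (Fin p) ℝ, S = star B * B := by
    open scoped MatrixOrder Matrix.Norms.L2Operator in
    exact CStarAlgebra.nonneg_iff_eq_star_mul_self.mp hS.nonneg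
  set BE := Matrix.toEuclideanCLM (𝕜 := ℝ) B with hBE
  have hn : ‖BE d‖ = ‖w‖ := by
    have h1 : ‖BE d‖ ^ 2 = ‖w‖ ^ 2 := by
      rw [hw, hB, ← Matrix.inner_toEuclideanCLM, map_mul, map_star, mul_apply_eq_comp,
        ContinuousLinearMap.star_eq_adjoint, ContinuousLinearMap.adjoint_inner_right,
        real_inner_self_eq_norm_sq]
    exact (sq_eq_sq₀ (norm_nonneg _) (norm_nonneg _)).1 h1
  -- Vectors of equal norm are exchanged by the reflection in the hyperplane orthogonal to their
  -- difference; composing with this isometry leaves $B^TB$ unchanged.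
  set R : EuclideanSpace ℝ (Fin p) →L[ℝ] EuclideanSpace ℝ (Fin p) :=
    ((ℝ ∙ (BE d - w))ᗮ.reflection.toContinuousLinearEquiv :
      EuclideanSpace ℝ (Fin p) →L[ℝ] EuclideanSpace ℝ (Fin p)) with hR
  have hRd : R (BE d) = w := Submodule.reflection_sub hn
  have hRR : star R * R = 1 := by
    rw [ContinuousLinearMap.star_eq_adjoint]
    exact (ContinuousLinearMap.norm_map_iff_adjoint_comp_self R).1 fun x =>
      LinearIsometryEquiv.norm_map _ x
  obtain ⟨Q, hQ⟩ : ∃ Q, Matrix.toEuclideanCLM (𝕜 := ℝ) Q = R :=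
    EquivLike.surjective (Matrix.toEuclideanCLM (𝕜 := ℝ) (n := Fin p)) R
  have hQQ : star Q * Q = 1 := by
    have h : Matrix.toEuclideanCLM (𝕜 := ℝ) (star Q * Q) = Matrix.toEuclideanCLM (𝕜 := ℝ) 1 := by
      rw [map_mul, map_star, map_one, hQ, hRR]
    exact EquivLike.injective (Matrix.toEuclideanCLM (𝕜 := ℝ) (n := Fin p)) h
  refine ⟨Q * B, ?_, ?_⟩
  · rw [hB, ← Matrix.conjTranspose_eq_transpose_of_trivial, ← Matrix.star_eq_conjTranspose,
      star_mul, mul_assoc, ← mul_assoc _ _ B, hQQ, one_mul]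
  · rw [map_mul, hQ, mul_apply_eq_comp, hRd]

/-- `C` whitens the covariance `S`: from $C^T(CS)=1$ the factors commute, since a one-sided inverse
of a square matrix is two-sided. -/
theorem mul_mul_transpose_eq_one {S C : Matrix (Fin p) (Fin p) ℝ} (hS : IsUnit S.det)
    (hC : Cᵀ * C = S⁻¹) : IsUnit C.det ∧ C * S * Cᵀ = 1 := by
  have h0 : IsUnit C.det := by
    have h1 : IsUnit (Cᵀ * C).det := by rw [hC]; exact Matrix.isUnit_nonsing_inv_det S hS
    rw [Matrix.det_mul] at h1
    exact isUnit_of_mul_isUnit_right h1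
  refine ⟨h0, ?_⟩
  have h2 : Cᵀ * (C * S) = 1 := by
    rw [← mul_assoc, hC, Matrix.nonsing_inv_mul _ hS]
  exact mul_eq_one_comm.1 h2

theorem dotProduct_mulVec_eq_norm_sq {L K : Matrix (Fin p) (Fin p) ℝ} (h : Lᵀ * K * L = 1)
    (t : EuclideanSpace ℝ (Fin p)) :
    (Matrix.toEuclideanCLM (𝕜 := ℝ) L t).ofLp ⬝ᵥ (K *ᵥ (Matrix.toEuclideanCLM (𝕜 := ℝ) L t).ofLp)
      = ‖t‖ ^ 2 := by
  rw [Matrix.ofLp_toEuclideanCLM, Matrix.mulVec_mulVec, dotProduct_comm,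
    Matrix.dotProduct_mulVec, ← Matrix.mulVec_transpose, Matrix.mulVec_mulVec, ← mul_assoc,
    show Lᵀ * K * L = 1 from h, Matrix.one_mulVec, EuclideanSpace.real_norm_sq_eq]
  simp [dotProduct, sq]

theorem inner_toEuclideanCLM_left (L : Matrix (Fin p) (Fin p) ℝ)
    (v t : EuclideanSpace ℝ (Fin p)) :
    inner ℝ (Matrix.toEuclideanCLM (𝕜 := ℝ) L v) t
      = inner ℝ v (Matrix.toEuclideanCLM (𝕜 := ℝ) Lᵀ t) := by
  rw [← Matrix.conjTranspose_eq_transpose_of_trivial, ← Matrix.star_eq_conjTranspose, map_star,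
    ContinuousLinearMap.star_eq_adjoint, ContinuousLinearMap.adjoint_inner_right]

end LinearAlgebra

/-! ### Standard normal and noncentral chi-square laws -/

section Gaussian

variable {p : ℕ}

/-- The standard normal distribution on Euclidean space. -/
noncomputable def stdNormal (p : ℕ) : Measure (EuclideanSpace ℝ (Fin p)) :=
  (Measure.pi fun _ : Fin p => gaussianReal 0 1).map (WithLp.toLp 2)

theorem isProbabilityMeasure_stdNormal : IsProbabilityMeasure (stdNormal p) :=
  Measure.isProbabilityMeasure_map (by fun_prop)

theorem charFun_stdNormal (t : EuclideanSpace ℝ (Fin p)) :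
    charFun (stdNormal p) t = Complex.exp (-((‖t‖ ^ 2 : ℝ) : ℂ) / 2) := by
  rw [stdNormal, charFun_pi, EuclideanSpace.real_norm_sq_eq]
  simp only [charFun_gaussianReal]
  rw [← Complex.exp_sum]
  congr 1
  push_cast
  rw [neg_div, Finset.sum_div, ← Finset.sum_neg_distrib]
  refine Finset.sum_congr rfl fun i _ => ?_
  simp

/-- Translating each standard normal coordinate by $\sqrt{\delta/p}$ presents the limit law as a
continuous image of `stdNormal`. -/
theorem integral_noncentralChiSq (φ : ℝ →ᵇ ℝ) (δ : ℝ) :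
    ∫ y, φ y ∂(noncentralChiSq p δ)
      = ∫ z, φ (‖z + WithLp.toLp 2 (fun _ : Fin p => Real.sqrt (δ / p))‖ ^ 2) ∂(stdNormal p) := by
  have h1 : (Measure.pi fun _ : Fin p => gaussianReal (Real.sqrt (δ / p)) 1)
      = (Measure.pi fun _ : Fin p => gaussianReal 0 1).map
        (fun (z : Fin p → ℝ) i => z i + Real.sqrt (δ / p)) := by
    have h2 := Measure.pi_map_pi (μ := fun _ : Fin p => gaussianReal 0 1)
      (f := fun (_ : Fin p) (x : ℝ) => x + Real.sqrt (δ / p)) (hμ := fun _ => by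
        rw [gaussianReal_map_add_const]; infer_instance) (fun _ => by fun_prop)
    rw [h2]
    simp only [gaussianReal_map_add_const, zero_add]
  have hφ : Continuous fun y => φ y := φ.continuous
  have hm1 : Measurable fun z : Fin p → ℝ => ∑ i, z i ^ 2 := by fun_prop
  have hm2 : Measurable fun (z : Fin p → ℝ) i => z i + Real.sqrt (δ / p) := by fun_prop
  rw [noncentralChiSq, h1, Measure.map_map hm1 hm2, stdNormal,
    integral_map (hm1.comp hm2).aemeasurable (by fun_prop), integral_map (by fun_prop)
      (by fun_prop)]
  refine integral_congr_ae (Eventually.of_forall fun z => ?_)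
  simp [EuclideanSpace.real_norm_sq_eq]

end Gaussian

variable {𝓧 : Type*} [MeasurableSpace 𝓧] {p : ℕ}

/-! ### Asymptotics of the divergence estimator -/

theorem solvesEstimatingEq_iff {μ : Measure 𝓧} {β : ℝ} {f : EuclideanSpace ℝ (Fin p) → 𝓧 → ℝ}
    {n : ℕ} (hn : 1 ≤ n) (X : Fin n → 𝓧) (θ : EuclideanSpace ℝ (Fin p)) :
    SolvesEstimatingEq μ β f X θ ↔ sampleMean (dpdScore μ β f) X θ = 0 := by
  have hn0 : (n : ℝ) ≠ 0 := by exact_mod_cast (by omega : n ≠ 0)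
  rw [SolvesEstimatingEq, sampleMean]
  simp only [dpdScore, Finset.sum_sub_distrib, Finset.sum_const, Finset.card_univ,
    Fintype.card_fin, smul_sub, ← Nat.cast_smul_eq_nsmul ℝ, smul_smul, inv_mul_cancel₀ hn0, one_smul]

theorem tendsto_localAlt (θ₀ d : EuclideanSpace ℝ (Fin p)) :
    Tendsto (localAlt θ₀ d) atTop (𝓝 θ₀) := by
  have : Tendsto (fun n : ℕ => (Real.sqrt n)⁻¹) atTop (𝓝 0) :=
    tendsto_inv_atTop_zero.comp (Real.tendsto_sqrt_atTop.comp tendsto_natCast_atTop_atTop)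
  have h1 := (this.smul_const d).const_add θ₀
  rwa [zero_smul, add_zero] at h1

namespace RegularModel

variable {μ : Measure 𝓧} {β : ℝ} {f : EuclideanSpace ℝ (Fin p) → 𝓧 → ℝ}
  {θ₀ : EuclideanSpace ℝ (Fin p)} {ω : Set (EuclideanSpace ℝ (Fin p))} {G : Set 𝓧}
  {M : Fin p → Fin p → Fin p → 𝓧 → ℝ}

/-- Its quadratic form is the second moment of a projection of the estimating function. -/
theorem posSemidef_Kmat (H : RegularModel μ β f θ₀ ω G M) :
    (Kmat μ β f (f θ₀) θ₀).PosSemidef := by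
  refine Matrix.PosSemidef.of_dotProduct_mulVec_nonneg ?_ fun v => ?_
  · ext i j
    simp only [Kmat, Matrix.conjTranspose_apply, Matrix.of_apply, star_trivial]
    congr 1
    · congr 1
      funext x
      ring
    · ring
  · rw [star_trivial]
    have := H.integral_inner_dpdScore_sq H.mem (WithLp.toLp 2 v)
    rw [← this]
    exact integral_nonneg fun x => sq_nonneg _

/-- The central limit theorem for the estimating function along a sequence of parameters. -/
theorem tendsto_charFun_dpdScore (H : RegularModel μ β f θ₀ ω G M)
    (hK : ContinuousAt (fun θ => Kmat μ β f (f θ) θ) θ₀) {θ : ℕ → EuclideanSpace ℝ (Fin p)}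
    (hθ : Tendsto θ atTop (𝓝 θ₀)) (hm : ∀ n, Measurable (f (θ n))) (h0 : ∀ n x, 0 ≤ f (θ n) x)
    (h1 : ∀ n, ∫ x, f (θ n) x ∂μ = 1) (s : EuclideanSpace ℝ (Fin p)) :
    Tendsto (fun n : ℕ => ∫ X, Complex.exp (((Real.sqrt n)⁻¹ *
        ∑ k, inner ℝ (dpdScore μ β f (θ n) (X k)) s : ℝ) * Complex.I)
      ∂(sampleLaw μ (f (θ n)) n)) atTop
      (𝓝 (Complex.exp (-((s.ofLp ⬝ᵥ (Kmat μ β f (f θ₀) θ₀ *ᵥ s.ofLp) : ℝ) : ℂ) / 2))) := by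
  have hω : ∀ᶠ n in atTop, θ n ∈ ω := hθ.eventually (H.isOpen.mem_nhds H.mem)
  have e0 : ∫ x, f θ₀ x * inner ℝ (dpdScore μ β f θ₀ x) s ^ 2 ∂μ
      = s.ofLp ⬝ᵥ (Kmat μ β f (f θ₀) θ₀ *ᵥ s.ofLp) := by
    rw [← H.integral_inner_dpdScore_sq H.mem s, integral_law (H.measurable θ₀ H.mem)
      (H.nonneg θ₀ H.mem)]
    rfl
  rw [← e0]
  refine tendsto_charFun_array (f := fun n => f (θ n)) (f₀ := f θ₀)
    (y := fun n x => inner ℝ (dpdScore μ β f (θ n) x) s)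
    (y₀ := fun x => inner ℝ (dpdScore μ β f θ₀ x) s) hm h0 (fun n => isProbabilityMeasure_law (h0 n) (h1 n))
    (H.nonneg θ₀ H.mem) ?_ ?_ ?_ ?_ ?_
  · filter_upwards [hω] with n hn
    exact H.memLp_inner_dpdScore hn s
  · filter_upwards [hω] with n hn
    obtain ⟨hi, hz⟩ := H.integrable_dpdScore hn
    have e : (fun x => inner ℝ (dpdScore μ β f (θ n) x) s)
        = fun x => inner ℝ s (dpdScore μ β f (θ n) x) := funext fun x => real_inner_comm _ _
    rw [e, integral_inner hi, hz, inner_zero_right]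
  · rw [e0]
    have hc : Tendsto (fun n => s.ofLp ⬝ᵥ (Kmat μ β f (f (θ n)) (θ n) *ᵥ s.ofLp)) atTop
        (𝓝 (s.ofLp ⬝ᵥ (Kmat μ β f (f θ₀) θ₀ *ᵥ s.ofLp))) := by
      have hq : Continuous fun A : Matrix (Fin p) (Fin p) ℝ => s.ofLp ⬝ᵥ (A *ᵥ s.ofLp) := by
        fun_prop
      exact (hq.tendsto _).comp (hK.tendsto.comp hθ)
    refine hc.congr' ?_
    filter_upwards [hω] with n hn
    exact (H.integral_inner_dpdScore_sq hn s).symm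
  · exact (integrable_law (H.measurable θ₀ H.mem) (H.nonneg θ₀ H.mem)).1
      (H.memLp_inner_dpdScore H.mem s).integrable_sq
  -- Smoothness in the parameter gives the pointwise limits on `G`; elsewhere the densities are
  -- eventually zero.
  · filter_upwards [H.ae_mem] with x hx
    rcases hx with hx | hx
    · exact Or.inr ⟨((H.continuousAt_dpdScore hx H.mem).tendsto.comp hθ).inner tendsto_const_nhds,
        (H.continuousAt_density hx H.mem).tendsto.comp hθ⟩
    · exact Or.inl ⟨hω.mono fun n hn => hx _ hn, hx _ H.mem⟩

theorem aemeasurable_sampleMean (H : RegularModel μ β f θ₀ ω G M)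
    {θ : EuclideanSpace ℝ (Fin p)} (hθ : θ ∈ ω) (n : ℕ) :
    AEMeasurable (fun X => sampleMean (dpdScore μ β f) X θ) (sampleLaw μ (f θ) n) := by
  have := H.isProbabilityMeasure hθ
  have h1 : Measurable fun X : Fin n → 𝓧 =>
      (n : ℝ)⁻¹ • ∑ i, G.indicator (dpdScore μ β f θ) (X i) :=
    (Finset.measurable_fun_sum _ fun i _ => (H.measurable_indicator_dpdScore hθ).comp
      (measurable_pi_apply i)).const_smul (n : ℝ)⁻¹
  refine ⟨_, h1, ?_⟩
  filter_upwards [ae_pi_forall (H.ae_mem_law hθ) n] with X hX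
  simp [sampleMean, hX]

theorem exists_isConsistentMDPDE (H : RegularModel μ β f θ₀ ω G M)
    {Θ : Set (EuclideanSpace ℝ (Fin p))} (hsub : ω ⊆ Θ) (hJ : (Jmat μ β f (f θ₀) θ₀).PosDef) :
    ∃ T, IsConsistentMDPDE μ β Θ f θ₀ T := by
  have := H.isProbabilityMeasure H.mem
  obtain ⟨r, hr, hrω⟩ := Metric.nhds_basis_closedBall.mem_iff.1 (H.isOpen.mem_nhds H.mem)
  have hJd : IsUnit (Jmat μ β f (f θ₀) θ₀).det := (Matrix.isUnit_iff_isUnit_det _).1 hJ.isUnit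
  obtain ⟨T, hTm, hTr, hT0, hTc⟩ := (H.regularEstimatingFunction hr hrω).exists_consistent_root
    (J' := Matrix.toEuclideanCLM (𝕜 := ℝ) (Jmat μ β f (f θ₀) θ₀)⁻¹)
    (fun v => by
      rw [← mul_apply_eq_comp, ← map_mul, Matrix.nonsing_inv_mul _ hJd, map_one]
      rfl)
    (fun v => by
      rw [← mul_apply_eq_comp, ← map_mul, Matrix.mul_nonsing_inv _ hJd, map_one]
      rfl)
    (fun θ hθ => H.measurable_indicator_dpdScore (hrω hθ))
  refine ⟨T, hTm, fun n X => hsub (hrω (hTr n X)), hT0.congr' ?_, hTc⟩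
  filter_upwards [eventually_ge_atTop 1] with n hn
  simp only [solvesEstimatingEq_iff hn]
  rfl

/-- The limit law of a consistent root of the estimating equation under contiguous alternatives, in
coordinates in which the asymptotic covariance is the identity. -/
theorem tendsto_charFun_estimator (H : RegularModel μ β f θ₀ ω G M)
    (hK : ContinuousAt (fun θ => Kmat μ β f (f θ) θ) θ₀)
    {J C : Matrix (Fin p) (Fin p) ℝ} (hJ : Jmat μ β f (f θ₀) θ₀ = J) (hJd : IsUnit J.det)
    (hJs : Jᵀ = J) (hCd : IsUnit C.det)
    (hC : C * (J⁻¹ * Kmat μ β f (f θ₀) θ₀ * J⁻¹) * Cᵀ = 1)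
    {Θ : Set (EuclideanSpace ℝ (Fin p))} {θ : ℕ → EuclideanSpace ℝ (Fin p)}
    (hθ : Tendsto θ atTop (𝓝 θ₀)) (hm : ∀ n, Measurable (f (θ n))) (h0 : ∀ n x, 0 ≤ f (θ n) x)
    (h1 : ∀ n, ∫ x, f (θ n) x ∂μ = 1)
    (hcont : IsContiguous (fun n => sampleLaw μ (f (θ n)) n) (fun n => sampleLaw μ (f θ₀) n))
    {T : (n : ℕ) → (Fin n → 𝓧) → EuclideanSpace ℝ (Fin p)} (hT : IsConsistentMDPDE μ β Θ f θ₀ T)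
    (t : EuclideanSpace ℝ (Fin p)) :
    Tendsto (fun n : ℕ => ∫ X, Complex.exp (inner ℝ (Matrix.toEuclideanCLM (𝕜 := ℝ) C
        (Real.sqrt n • (T n X - θ n))) t * Complex.I) ∂(sampleLaw μ (f (θ n)) n)) atTop
      (𝓝 (charFun (stdNormal p) t)) := by
  classical
  have hP0 := H.isProbabilityMeasure H.mem
  have hP : ∀ n, IsProbabilityMeasure (sampleLaw μ (f (θ n)) n) := fun n => by
    have := isProbabilityMeasure_law (h0 n) (h1 n)
    unfold sampleLaw
    infer_instance
  have hN := isProbabilityMeasure_stdNormal (p := p)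
  have hω : ∀ᶠ n in atTop, θ n ∈ ω := hθ.eventually (H.isOpen.mem_nhds H.mem)
  set CE := Matrix.toEuclideanCLM (𝕜 := ℝ) C with hCE
  set J' := Matrix.toEuclideanCLM (𝕜 := ℝ) J⁻¹ with hJ'
  -- The leading linear term. The value 0 for the finitely many `θ n` outside `ω` ensures a.e.
  -- measurability for every `n`.
  set S : (n : ℕ) → (Fin n → 𝓧) → EuclideanSpace ℝ (Fin p) := fun n X =>
    if θ n ∈ ω then CE (J' (Real.sqrt n • sampleMean (dpdScore μ β f) X (θ n))) else 0 with hS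
  obtain ⟨r, hr, hrω⟩ := Metric.nhds_basis_closedBall.mem_iff.1 (H.isOpen.mem_nhds H.mem)
  refine tendsto_charFun_of_relative_error (fun n => sampleLaw μ (f (θ n)) n) (S := S)
    (fun n => ?_) (fun n => ?_) (stdNormal p) (fun t => ?_) (fun η hη => ?_) t
  · exact (CE.continuous.measurable.comp (((hT.measurable n).sub_const (θ n)).const_smul
      (Real.sqrt n))).aemeasurable
  · by_cases hn : θ n ∈ ω
    · simp only [hS, hn, if_true]
      have hmean := (H.aemeasurable_sampleMean hn n).const_smul (Real.sqrt n)
      exact CE.continuous.measurable.comp_aemeasurable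
        (J'.continuous.measurable.comp_aemeasurable hmean)
    · simp only [hS, hn, if_false]
      exact aemeasurable_const
  · have hlim := H.tendsto_charFun_dpdScore hK hθ hm h0 h1
      (Matrix.toEuclideanCLM (𝕜 := ℝ) (J⁻¹ * Cᵀ) t)
    -- In these coordinates the limiting variance in direction `t` is $\|t\|^2$, as for the standard
    -- normal.
    have hLK : (J⁻¹ * Cᵀ)ᵀ * Kmat μ β f (f θ₀) θ₀ * (J⁻¹ * Cᵀ) = 1 := by
      rw [← hC, Matrix.transpose_mul, Matrix.transpose_transpose, Matrix.transpose_nonsing_inv, hJs]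
      simp only [mul_assoc]
    rw [dotProduct_mulVec_eq_norm_sq hLK] at hlim
    rw [charFun_stdNormal]
    refine hlim.congr' ?_
    filter_upwards [hω] with n hn
    refine integral_congr_ae (Eventually.of_forall fun X => ?_)
    have hinner : inner ℝ (S n X) t = (Real.sqrt n)⁻¹ * ∑ k,
        inner ℝ (dpdScore μ β f (θ n) (X k)) (Matrix.toEuclideanCLM (𝕜 := ℝ) (J⁻¹ * Cᵀ) t) := by
      have e1 : S n X = Matrix.toEuclideanCLM (𝕜 := ℝ) (C * J⁻¹)
          (Real.sqrt n • sampleMean (dpdScore μ β f) X (θ n)) := by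
        simp only [hS, hn, if_true, map_mul]
        rfl
      rw [e1, inner_toEuclideanCLM_left, Matrix.transpose_mul, Matrix.transpose_nonsing_inv, hJs,
        sampleMean, inner_smul_left, inner_smul_left, sum_inner, ← mul_assoc]
      congr 1
      simp only [conj_trivial]
      rw [← div_eq_mul_inv, Real.sqrt_div_self', one_div]
    simp only [hinner]
  · have hlin := (H.regularEstimatingFunction hr hrω).tendsto_relative_error
      (A := CE) (A' := Matrix.toEuclideanCLM (𝕜 := ℝ) C⁻¹) (J' := J')
      (fun v => by
        rw [hJ', hJ, ← mul_apply_eq_comp, ← map_mul, Matrix.nonsing_inv_mul _ hJd,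
          map_one]
        rfl)
      (fun v => by
        rw [hCE, ← mul_apply_eq_comp, ← map_mul, Matrix.nonsing_inv_mul _ hCd, map_one]
        rfl)
      hθ (T := T) (hT.root.congr' (by
        filter_upwards [eventually_ge_atTop 1] with n hn
        simp only [solvesEstimatingEq_iff hn]
        rfl)) hT.consistent hη
    -- The only use of contiguity: the linearization, proved under $f_{\theta_0}$, is carried over
    -- to the alternatives.
    refine (hcont.tendsto hlin).congr' ?_
    filter_upwards [hω] with n hn
    simp only [hS, hn, if_true]

end RegularModel

end DPD

/-! ### The Wald-type statistic under contiguous alternatives -/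

theorem mainTheorem4 {𝓧 : Type*} [MeasurableSpace 𝓧] (μ : Measure 𝓧) [SigmaFinite μ] (p : ℕ)
    (β : ℝ) (hβ : 0 ≤ β)
    (Θ : Set (EuclideanSpace ℝ (Fin p))) (f : EuclideanSpace ℝ (Fin p) → 𝓧 → ℝ)
    (hf : DPD.IsDensityFamily μ Θ f)
    (θ₀ : EuclideanSpace ℝ (Fin p)) (ω : Set (EuclideanSpace ℝ (Fin p)))
    (hreg : DPD.RegularityConditions μ β Θ f (f θ₀) θ₀ ω)
    -- the matrix `K_β` exists on `ω`, is continuous at `θ₀`, and is invertible there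
    (hKint : ∀ θ ∈ ω, ∀ i,
      Integrable (fun x => DPD.score f θ x i ^ 2 * f θ x ^ (2 * β) * f θ x) μ)
    (hKcont : ContinuousAt (fun θ => DPD.Kmat μ β f (f θ) θ) θ₀)
    (hKinv : IsUnit (DPD.Kmat μ β f (f θ₀) θ₀).det)
    -- the local alternatives lie in `Θ` and are contiguous to the null hypothesis
    (d : EuclideanSpace ℝ (Fin p)) (hd : ∀ n : ℕ, 1 ≤ n → DPD.localAlt θ₀ d n ∈ Θ)
    (hcont : DPD.IsContiguous (fun n => DPD.sampleLaw μ (f (DPD.localAlt θ₀ d n)) n)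
      (fun n => DPD.sampleLaw μ (f θ₀) n)) :
    (∃ T, DPD.IsConsistentMDPDE μ β Θ f θ₀ T) ∧
    ∀ T, DPD.IsConsistentMDPDE μ β Θ f θ₀ T →
      DPD.ConvergesInLaw (fun n => DPD.sampleLaw μ (f (DPD.localAlt θ₀ d n)) n)
        (DPD.waldStat μ β f θ₀ T)
        (DPD.noncentralChiSq p (d.ofLp ⬝ᵥ ((DPD.asympCov μ β f θ₀)⁻¹ *ᵥ d.ofLp))) := by
  obtain ⟨G, M, H⟩ := DPD.exists_regularModel hβ hf hreg hKint
  refine ⟨H.exists_isConsistentMDPDE hreg.subset hreg.posDef, fun T hT φ => ?_⟩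
  set J := DPD.Jmat μ β f (f θ₀) θ₀ with hJ
  set K := DPD.Kmat μ β f (f θ₀) θ₀ with hK
  have hJd : IsUnit J.det := (Matrix.isUnit_iff_isUnit_det _).1 hreg.posDef.isUnit
  have hJs : Jᵀ = J := by
    rw [← Matrix.conjTranspose_eq_transpose_of_trivial]
    exact hreg.posDef.isHermitian
  set A := DPD.asympCov μ β f θ₀ with hA
  have hAdef : A = J⁻¹ * K * J⁻¹ := rfl
  have hAp : A.PosSemidef := by
    have h1 := H.posSemidef_Kmat.conjTranspose_mul_mul_same J⁻¹
    rwa [Matrix.conjTranspose_eq_transpose_of_trivial, Matrix.transpose_nonsing_inv, hJs] at h1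
  have hAd : IsUnit A.det := by
    have hJi := Matrix.isUnit_nonsing_inv_det J hJd
    rw [hAdef, Matrix.det_mul, Matrix.det_mul]
    exact (hJi.mul hKinv).mul hJi
  set δ := d.ofLp ⬝ᵥ (A⁻¹ *ᵥ d.ofLp) with hδ
  have hδ0 : 0 ≤ δ := by simpa using hAp.inv.dotProduct_mulVec_nonneg d.ofLp
  set w : EuclideanSpace ℝ (Fin p) := WithLp.toLp 2 (fun _ : Fin p => Real.sqrt (δ / p)) with hw
  have hwn : ‖w‖ ^ 2 = δ := by
    rw [EuclideanSpace.real_norm_sq_eq]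
    simp only [hw, Real.sq_sqrt (div_nonneg hδ0 (Nat.cast_nonneg p)), Finset.sum_const,
      Finset.card_univ, Fintype.card_fin, nsmul_eq_mul]
    -- For $p=0$ the quotient $\delta/p$ is meaningless, but $\delta$ is an empty sum.
    rcases Nat.eq_zero_or_pos p with hp | hp
    · subst hp
      simp [hδ, dotProduct]
    · have : (p : ℝ) ≠ 0 := by exact_mod_cast hp.ne'
      field_simp
  obtain ⟨C, hCC, hCw⟩ := DPD.exists_factor_map_eq hAp.inv d w hwn
  obtain ⟨hCd, hCA⟩ := DPD.mul_mul_transpose_eq_one hAd hCC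
  have hmem : ∀ n, DPD.localAlt θ₀ d n ∈ Θ := by
    intro n
    -- For $n=0$ the inverse of $\sqrt0$ is zero by convention, so the alternative is `θ₀` itself.
    rcases Nat.eq_zero_or_pos n with hn | hn
    · subst hn
      simpa [DPD.localAlt] using hreg.subset hreg.mem
    · exact hd n hn
  have hchar := H.tendsto_charFun_estimator hKcont hJ.symm hJd hJs hCd (by rwa [hAdef] at hCA)
    (DPD.tendsto_localAlt θ₀ d) (fun n => hf.measurable _ (hmem n)) (fun n => hf.nonneg _ (hmem n))
    (fun n => hf.integral_eq_one _ (hmem n)) hcont hT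
  have hP : ∀ n, IsProbabilityMeasure (DPD.sampleLaw μ (f (DPD.localAlt θ₀ d n)) n) := fun n => by
    have := DPD.isProbabilityMeasure_law (hf.nonneg _ (hmem n)) (hf.integral_eq_one _ (hmem n))
    unfold DPD.sampleLaw
    infer_instance
  have hN := DPD.isProbabilityMeasure_stdNormal (p := p)
  let q : C(EuclideanSpace ℝ (Fin p), ℝ) := ⟨fun z => ‖z + w‖ ^ 2, by fun_prop⟩
  have hlim := DPD.tendsto_integral_of_tendsto_charFun _ (fun n =>
    ((Matrix.toEuclideanCLM (𝕜 := ℝ) C).continuous.measurable.comp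
      (((hT.measurable n).sub_const (DPD.localAlt θ₀ d n)).const_smul
        (Real.sqrt n))).aemeasurable) (DPD.stdNormal p) hchar (φ.compContinuous q)
  rw [DPD.integral_noncentralChiSq]
  refine hlim.congr' ?_
  filter_upwards [eventually_ge_atTop 1] with n hn
  refine integral_congr_ae (Eventually.of_forall fun X => ?_)
  have hn0 : (0 : ℝ) < n := by exact_mod_cast hn
  change φ (‖Matrix.toEuclideanCLM (𝕜 := ℝ) C (Real.sqrt n • (T n X - DPD.localAlt θ₀ d n)) + w‖ ^ 2)
    = φ (DPD.waldStat μ β f θ₀ T n X)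
  congr 1
  -- As $w=Cd$ and $\sqrt n(\theta_n-\theta_0)=d$ for $n\ge1$, adding `w` recentres the estimator
  -- from $\theta_n$ to $\theta_0$.
  have e1 : Matrix.toEuclideanCLM (𝕜 := ℝ) C (Real.sqrt n • (T n X - DPD.localAlt θ₀ d n)) + w
      = Real.sqrt n • Matrix.toEuclideanCLM (𝕜 := ℝ) C (T n X - θ₀) := by
    rw [← hCw, ← map_smul, ← map_add]
    congr 1
    rw [DPD.localAlt, ← sub_sub, smul_sub _ _ ((Real.sqrt n)⁻¹ • d), smul_smul,
      mul_inv_cancel₀ (Real.sqrt_pos.2 hn0).ne', one_smul, sub_add_cancel]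
  rw [e1, norm_smul, mul_pow, Real.norm_of_nonneg (Real.sqrt_nonneg _), Real.sq_sqrt hn0.le,
    DPD.waldStat, ← hA, ← hCC, ← Matrix.inner_toEuclideanCLM, map_mul,
    ← Matrix.conjTranspose_eq_transpose_of_trivial, ← Matrix.star_eq_conjTranspose, map_star,
    mul_apply_eq_comp, ContinuousLinearMap.star_eq_adjoint,
    ContinuousLinearMap.adjoint_inner_right, real_inner_self_eq_norm_sq]
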